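/- Let $Y\subseteq\mathbb P^N_{\mathbb C}$ be a smooth projective variety (irreducible, nonempty), let $X\subseteq\mathbb C^{N+1}$ be its affine cone with vertex $P=0$, assume that $X$ is normal, and put $U=X\setminus\{P\}$, with the free action of $\mathbb C^*$ by scalar multiplication and the quotient $U\to Y$. For $e\in\mathbb Z$ let $H_Y^e\to Y$ be the line bundle that is the quotient of $U\times\mathbb C$ by the action $\lambda(x,t)=(\lambda x,\lambda^e t)$. Let $f_1,\dots,f_n$ be holomorphic functions on $X$ that are homogeneous of degrees $d_1,\dots,d_n\in\mathbb Z$, i.e. $f_i(\lambda x)=\lambda^{d_i}f_i(x)$ for $\lambda\in\mathbb C^*$, $x\in X$, and suppose that $\{f_1=\dots=f_n=0\}=\{P\}$. A homogeneous function $f$ of degree $d$ is regarded as the homomorphism $H_Y^{e}\to H_Y^{e+d}$, $[x,t]\mapsto[x,f(x)t]$. Let $e_1,\dots,e_n\in\mathbb Z$ be such that $m=d_i+e_i$ does not depend on $i$. Then the following hold. (i) $V_m:=\ker\bigl(\sum f_i: H_Y^{e_1}\times_Y\cdots\times_Y H_Y^{e_n}\to H_Y^m\bigr)$ is a holomorphic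 vector bundle of rank $n-1$ on $Y$, and there is an exact sequence of holomorphic vector bundles $$0\longrightarrow V_m\longrightarrow H_Y^{e_1}\times_Y\cdots\times_Y H_Y^{e_n}\stackrel{\sum f_i}{\longrightarrow}H_Y^m\longrightarrow 0 .$$ (ii) The (total space of the) bundle $V_m$ is the quotient of $V(f_1t_1+\dots+f_nt_n)|_U=\{(x,t)\in U\times\mathbb C^n : \sum f_i(x)t_i=0\}$ by the action of $\mathbb C^*$ given by $\lambda(x,t_1,\dots,t_n)=(\lambda x,\lambda^{e_1}t_1,\dots,\lambda^{e_n}t_n)$, with quotient map $(x,t_1,\dots,t_n)\mapsto([x,t_1],\dots,[x,t_n])$: this map is surjective, its fibers are the orbits, $V_m$ carries the quotient topology, and the holomorphic functions on an open subset of $V_m$ are the invariant holomorphic functions on its preimage. (iii) $\operatorname{Det}V_m=\Lambda^{n-1}V_m\cong H_Y^{k}$, where $k=\sum_{i=1}^n e_i-m=-\sum_{i=1}^n d_i+(n-1)m$. (iv) Let $e_1',\dots,e_n'\in\mathbb Z$ be such that $m'=d_i+e_i'$ does not depend on $i$ either, and let $V_{m'}$ be the corresponding bundle. Then $V_m\otimes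 H_Y^{m'-m}\cong V_{m'}$ by the isomorphism of holomorphic vector bundles $([x,t_i])_i\otimes[x,s]\mapsto([x,t_is])_i$. The projective bundle $\mathbb P(V_m)$ of lines in $V_m$ does not depend on $m$: there is a biholomorphic map $\mathbb P(V_m)\cong\mathbb P(V_{m'})$ over $Y$ which maps the line of $([x,t_i])_i\in V_m$ to the line of $([x,t_i])_i\in V_{m'}$, for all $(x,t)\in V(\sum f_it_i)|_U$ with $t\neq0$. -/

import Mathlib

open scoped TensorProduct Topology

noncomputable section

/-! ## Reduced complex spaces as spaces with a sheaf of holomorphic functions -/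

/-- A topological space with a sheaf of continuous complex valued functions. `HolAt g x` says that
(the germ at `x` of) the function `g` is holomorphic at `x`. The laws say that this depends only on
the germ, that it is an open condition, that holomorphic functions are continuous, and that an
analytic function of finitely many holomorphic functions is holomorphic. -/
class HolSpace (Z : Type) where
  top : TopologicalSpace Z
  HolAt : (Z → ℂ) → Z → Prop
  hol_congr : ∀ {g h : Z → ℂ} {x : Z}, (∀ᶠ z in @nhds Z top x, g z = h z) → HolAt g x → HolAt h x
  hol_eventually : ∀ {g : Z → ℂ} {x : Z}, HolAt g x → ∀ᶠ z in @nhds Z top x, HolAt g z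
  hol_continuousAt : ∀ {g : Z → ℂ} {x : Z}, HolAt g x → @ContinuousAt Z ℂ top _ g x
  hol_comp : ∀ {κ : Type} [Fintype κ] {g : κ → Z → ℂ} {G : (κ → ℂ) → ℂ} {x : Z},
    (∀ k, HolAt (g k) x) → AnalyticAt ℂ G (fun k => g k x) → HolAt (fun z => G (fun k => g k z)) x

namespace HolSpace

/-- Holomorphic maps: continuous maps which pull back holomorphic functions to holomorphic ones. -/
def HolMap {A B : Type} [HolSpace A] [HolSpace B] (φ : A → B) : Prop :=
  (@Continuous A B top top φ) ∧ ∀ (a : A) (g : B → ℂ), HolAt g (φ a) → HolAt (g ∘ φ) a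

/-- Isomorphisms of complex spaces. -/
def Biholomorphic {A B : Type} [HolSpace A] [HolSpace B] (φ : A ≃ B) : Prop :=
  HolMap φ ∧ HolMap φ.symm

/-- The standard structure on a complex normed space. -/
abbrev ofNormed (E : Type) [NormedAddCommGroup E] [NormedSpace ℂ E] : HolSpace E where
  top := inferInstance
  HolAt g x := AnalyticAt ℂ g x
  hol_congr h hg := hg.congr h
  hol_eventually h := h.eventually_analyticAt
  hol_continuousAt h := h.continuousAt
  hol_comp h hG := AnalyticAt.comp hG (AnalyticAt.pi h)

instance : HolSpace ℂ := ofNormed ℂ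

instance (κ : Type) [Fintype κ] : HolSpace (κ → ℂ) := ofNormed (κ → ℂ)

/-- A map from `T` to some complex space. -/
structure Target (T : Type) where
  {Z : Type}
  [str : HolSpace Z]
  map : T → Z

attribute [instance] Target.str

/-- The structure on `T` induced by a family of maps to complex spaces: the topology is the coarsest
one for which these maps are continuous, and the holomorphic functions are locally the analytic
functions of finitely many pull-backs of holomorphic functions. -/
abbrev initial {T : Type} {ι : Type} (p : ι → Target T) : HolSpace T where
  top := ⨅ i, TopologicalSpace.induced (p i).map top
  HolAt f x := ∃ (κ : Type) (_ : Fintype κ) (i : κ → ι) (g : ∀ k, (p (i k)).Z → ℂ)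
    (G : (κ → ℂ) → ℂ), (∀ k, HolAt (g k) ((p (i k)).map x)) ∧
      AnalyticAt ℂ G (fun k => g k ((p (i k)).map x)) ∧
      ∀ᶠ z in @nhds T (⨅ i, TopologicalSpace.induced (p i).map top) x,
        f z = G (fun k => g k ((p (i k)).map z))
  hol_congr := by
    rintro g h x hgh ⟨κ, hκ, i, u, G, hu, hG, hf⟩
    refine ⟨κ, hκ, i, u, G, hu, hG, ?_⟩
    filter_upwards [hgh, hf] with z h1 h2
    rw [← h1, h2]
  hol_eventually := by
    rintro f x ⟨κ, hκ, i, u, G, hu, hG, hf⟩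
    let _ : TopologicalSpace T := ⨅ i, TopologicalSpace.induced (p i).map top
    have hc : ∀ j, @Continuous T (p j).Z _ top (p j).map := fun j =>
      continuous_iff_le_induced.2 (iInf_le _ j)
    have h1 : ∀ᶠ z in nhds x, ∀ k, HolAt (u k) ((p (i k)).map z) := by
      rw [Filter.eventually_all]
      intro k
      let _ : TopologicalSpace (p (i k)).Z := top
      exact (hc (i k)).continuousAt.eventually (hol_eventually (hu k))
    have h2 : ContinuousAt (fun z k => u k ((p (i k)).map z)) x := by
      rw [continuousAt_pi]
      intro k
      let _ : TopologicalSpace (p (i k)).Z := top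
      exact ContinuousAt.comp (f := (p (i k)).map) (hol_continuousAt (hu k))
        (hc (i k)).continuousAt
    filter_upwards [h1, h2.eventually hG.eventually_analyticAt, hf.eventually_nhds]
      with z a b c
    exact ⟨κ, hκ, i, u, G, a, b, c⟩
  hol_continuousAt := by
    rintro f x ⟨κ, hκ, i, u, G, hu, hG, hf⟩
    let _ : TopologicalSpace T := ⨅ i, TopologicalSpace.induced (p i).map top
    have hc : ∀ j, @Continuous T (p j).Z _ top (p j).map := fun j =>
      continuous_iff_le_induced.2 (iInf_le _ j)
    have h2 : ContinuousAt (fun z k => u k ((p (i k)).map z)) x := by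
      rw [continuousAt_pi]
      intro k
      let _ : TopologicalSpace (p (i k)).Z := top
      exact ContinuousAt.comp (f := (p (i k)).map) (hol_continuousAt (hu k))
        (hc (i k)).continuousAt
    exact (ContinuousAt.comp (f := fun z k => u k ((p (i k)).map z)) hG.continuousAt h2).congr
      (hf.mono fun z hz => hz.symm)
  hol_comp := by
    intro κ' _ f G' x hf hG'
    choose κ hκ i u G hu hG hf using hf
    refine ⟨Σ k', κ k', inferInstance, fun s => i s.1 s.2, fun s => u s.1 s.2,
      fun v => G' (fun k' => G k' (fun k => v ⟨k', k⟩)), fun s => hu s.1 s.2, ?_, ?_⟩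
    · refine AnalyticAt.comp (g := G')
        (f := fun v : (Σ k', κ k') → ℂ => fun k' => G k' (fun k => v ⟨k', k⟩)) ?_ ?_
      · have : (fun k' => f k' x)
            = fun k' => G k' (fun k => u k' k ((p (i k' k)).map x)) := by
          funext k'
          exact @Filter.Eventually.self_of_nhds T (_) x _ (hf k')
        rw [this] at hG'
        exact hG'
      · refine AnalyticAt.pi fun k' => ?_
        refine AnalyticAt.comp (g := G k')
          (f := fun v : (Σ k', κ k') → ℂ => fun k => v ⟨k', k⟩) (hG k') ?_
        exact AnalyticAt.pi fun k =>
          (ContinuousLinearMap.proj (R := ℂ) (φ := fun _ : Σ k', κ k' => ℂ) ⟨k', k⟩).analyticAt _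
    · filter_upwards [Filter.eventually_all.2 hf] with z hz
      congr 1
      funext k'
      exact hz k'

/-- Subspaces. -/
instance subtypeSpace {Z : Type} [HolSpace Z] (P : Z → Prop) : HolSpace (Subtype P) :=
  initial fun _ : Unit => ⟨Subtype.val⟩

/-- Products. -/
instance prodSpace {A B : Type} [HolSpace A] [HolSpace B] : HolSpace (A × B) :=
  initial ![⟨Prod.fst⟩, ⟨Prod.snd⟩]

/-- The structure on `T` coinduced by a family of maps from complex spaces: the topology is the
finest one for which these maps are continuous, and a function on an open set is holomorphic iff all
its pull-backs are. For a single surjective map this is the quotient structure. -/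
abbrev final {T : Type} {ι : Type*} {Z : ι → Type} [∀ i, HolSpace (Z i)] (q : ∀ i, Z i → T) :
    HolSpace T where
  top := ⨆ i, TopologicalSpace.coinduced (q i) top
  HolAt g p := ∃ A : Set T, (IsOpen[⨆ i, TopologicalSpace.coinduced (q i) top] A) ∧ p ∈ A ∧
    ∀ i, ∀ z : Z i, q i z ∈ A → HolAt (g ∘ q i) z
  hol_congr := by
    rintro g h x hgh ⟨A, hA, hx, hg⟩
    let _ : TopologicalSpace T := ⨆ i, TopologicalSpace.coinduced (q i) top
    obtain ⟨A', hA's, hA', hx'⟩ := eventually_nhds_iff.1 hgh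
    refine ⟨A ∩ A', hA.inter hA', ⟨hx, hx'⟩, fun i z hz => ?_⟩
    refine hol_congr ?_ (hg i z hz.1)
    let _ : TopologicalSpace (Z i) := top
    have hc : Continuous (q i) := continuous_iff_coinduced_le.2 (le_iSup
      (fun i => TopologicalSpace.coinduced (q i) top) i)
    filter_upwards [(hA'.preimage hc).mem_nhds hz.2] with w hw
    exact hA's _ hw
  hol_eventually := by
    rintro g x ⟨A, hA, hx, hg⟩
    let _ : TopologicalSpace T := ⨆ i, TopologicalSpace.coinduced (q i) top
    filter_upwards [hA.mem_nhds hx] with z hz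
    exact ⟨A, hA, hz, hg⟩
  hol_continuousAt := by
    rintro g x ⟨A, hA, hx, hg⟩
    let _ : TopologicalSpace T := ⨆ i, TopologicalSpace.coinduced (q i) top
    suffices h : ContinuousOn g A from h.continuousAt (hA.mem_nhds hx)
    rw [continuousOn_open_iff hA]
    intro O hO
    refine isOpen_iSup_iff.2 fun i => isOpen_coinduced.2 ?_
    let _ : TopologicalSpace (Z i) := top
    have hc : Continuous (q i) := continuous_iff_coinduced_le.2 (le_iSup
      (fun i => TopologicalSpace.coinduced (q i) top) i)
    have h : ContinuousOn (g ∘ q i) (q i ⁻¹' A) := fun z hz =>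
      (hol_continuousAt (hg i z hz)).continuousWithinAt
    exact h.isOpen_inter_preimage (hA.preimage hc) hO
  hol_comp := by
    intro κ _ f G x hf hG
    let _ : TopologicalSpace T := ⨆ i, TopologicalSpace.coinduced (q i) top
    choose A hA hx hg using hf
    have h2 : ContinuousAt (fun z k => f k z) x := by
      rw [continuousAt_pi]
      intro k
      suffices h : ContinuousOn (f k) (A k) from h.continuousAt ((hA k).mem_nhds (hx k))
      rw [continuousOn_open_iff (hA k)]
      intro O hO
      refine isOpen_iSup_iff.2 fun i => isOpen_coinduced.2 ?_
      let _ : TopologicalSpace (Z i) := top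
      have hc : Continuous (q i) := continuous_iff_coinduced_le.2 (le_iSup
        (fun i => TopologicalSpace.coinduced (q i) top) i)
      have h : ContinuousOn (f k ∘ q i) (q i ⁻¹' A k) := fun z hz =>
        (hol_continuousAt (hg k i z hz)).continuousWithinAt
      exact h.isOpen_inter_preimage ((hA k).preimage hc) hO
    obtain ⟨A', hA's, hA', hx'⟩ :=
      eventually_nhds_iff.1 (h2.eventually hG.eventually_analyticAt)
    refine ⟨(⋂ k, A k) ∩ A', (isOpen_iInter_of_finite hA).inter hA',
      ⟨Set.mem_iInter.2 hx, hx'⟩, fun i z hz => ?_⟩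
    exact hol_comp (g := fun k => f k ∘ q i) (fun k => hg k i z (Set.mem_iInter.1 hz.1 k))
      (hA's _ hz.2)

/-- `q : Z → Q` is the quotient of `Z` by the action of `G`: it is surjective, its fibers are the
orbits, `Q` has the quotient topology, and the holomorphic functions on an open subset of `Q` are
the invariant holomorphic functions on its preimage. -/
structure IsQuotient (G : Type) {Z Q : Type} [Group G] [MulAction G Z] [HolSpace Z] [HolSpace Q]
    (q : Z → Q) : Prop where
  surjective : Function.Surjective q
  fiber : ∀ z z' : Z, q z = q z' ↔ ∃ c : G, z' = c • z
  isOpen : ∀ A : Set Q, (IsOpen[top] A) ↔ (IsOpen[top] (q ⁻¹' A))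
  hol : ∀ (A : Set Q), (IsOpen[top] A) → ∀ g : Q → ℂ,
    (∀ p ∈ A, HolAt g p) ↔ ∀ z ∈ q ⁻¹' A, HolAt (g ∘ q) z

end HolSpace

open HolSpace

/-! ## Vector bundles -/

/-- A family of complex vector spaces over `B` whose total space is a complex space. -/
structure LinearSpace (B : Type) where
  fib : B → Type
  [acg : ∀ b, AddCommGroup (fib b)]
  [mod : ∀ b, Module ℂ (fib b)]
  hol : HolSpace (Σ b, fib b)

attribute [instance] LinearSpace.acg LinearSpace.mod

namespace LinearSpace

variable {B : Type}

/-- The total space. -/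
def Tot (E : LinearSpace B) : Type := Σ b, E.fib b

instance (E : LinearSpace B) : HolSpace E.Tot := E.hol

/-- The map of total spaces given by fiberwise linear maps. -/
def totMap {E F : LinearSpace B} (φ : ∀ b, E.fib b →ₗ[ℂ] F.fib b) (p : E.Tot) : F.Tot :=
  ⟨p.1, φ p.1 p.2⟩

/-- Homomorphisms of vector bundles: fiberwise linear and holomorphic on total spaces. -/
def IsHom {E F : LinearSpace B} (φ : ∀ b, E.fib b →ₗ[ℂ] F.fib b) : Prop := HolMap (totMap φ)

/-- Isomorphisms of vector bundles. -/
def IsIso {E F : LinearSpace B} (φ : ∀ b, E.fib b ≃ₗ[ℂ] F.fib b) : Prop :=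
  IsHom (fun b => (φ b).toLinearMap) ∧ IsHom (fun b => (φ b).symm.toLinearMap)

/-- The bijection of `E|_W` with `W × ℂ^r` given by a family of linear isomorphisms. -/
def trivEquiv (E : LinearSpace B) {r : ℕ} (W : Set B) (φ : ∀ b : W, E.fib b ≃ₗ[ℂ] (Fin r → ℂ)) :
    {p : E.Tot // p.1 ∈ W} ≃ W × (Fin r → ℂ) where
  toFun p := (⟨p.1.1, p.2⟩, φ ⟨p.1.1, p.2⟩ p.1.2)
  invFun w := ⟨⟨w.1.1, (φ w.1).symm w.2⟩, w.1.2⟩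
  left_inv := by
    rintro ⟨⟨b, v⟩, hb⟩
    simp
  right_inv := by
    rintro ⟨⟨b, hb⟩, a⟩
    simp

/-- A holomorphic local trivialization of rank `r`. -/
structure LocTriv [HolSpace B] (E : LinearSpace B) (r : ℕ) where
  W : Set B
  isOpen : IsOpen[top] W
  triv : ∀ b : W, E.fib b ≃ₗ[ℂ] (Fin r → ℂ)
  bihol : Biholomorphic (trivEquiv E W triv)

/-- `E` is a holomorphic vector bundle of rank `r`. -/
def IsVectorBundle [HolSpace B] (E : LinearSpace B) (r : ℕ) : Prop :=
  ∀ b : B, ∃ T : LocTriv E r, b ∈ T.W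

/-- The local frame of `E` given by a local trivialization. -/
def LocTriv.frame [HolSpace B] {E : LinearSpace B} {r : ℕ} (T : LocTriv E r) (b : T.W)
    (i : Fin r) : E.fib b :=
  (T.triv b).symm (Pi.single i 1)

/-- The fiber product `E_1 ×_B … ×_B E_n`. -/
abbrev prod [HolSpace B] {n : ℕ} (E : Fin n → LinearSpace B) : LinearSpace B where
  fib b := ∀ i, (E i).fib b
  hol := initial fun j : Option (Fin n) =>
    j.elim ⟨fun p => p.1⟩ (fun i => Target.mk (Z := (E i).Tot) fun p => ⟨p.1, p.2 i⟩)

/-- The kernel of a family of linear maps, a subspace of `E`. -/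
abbrev ker {E F : LinearSpace B} (φ : ∀ b, E.fib b →ₗ[ℂ] F.fib b) : LinearSpace B where
  fib b := LinearMap.ker (φ b)
  hol := initial fun _ : Unit => Target.mk (Z := E.Tot) fun p => ⟨p.1, p.2.1⟩

/-- The inclusion of the kernel. -/
def kerIncl {E F : LinearSpace B} (φ : ∀ b, E.fib b →ₗ[ℂ] F.fib b) (b : B) :
    (ker φ).fib b →ₗ[ℂ] E.fib b :=
  (LinearMap.ker (φ b)).subtype

/-- The tensor product; `u_i ⊗ v_j` is a local frame if `u` and `v` are. -/
def tensor [HolSpace B] (E F : LinearSpace B) : LinearSpace B where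
  fib b := E.fib b ⊗[ℂ] F.fib b
  hol := final
    (Z := fun T : Σ (r : ℕ) (s : ℕ), LocTriv E r × LocTriv F s =>
      {b : B // b ∈ T.2.2.1.W ∧ b ∈ T.2.2.2.W} × (Fin T.1 × Fin T.2.1 → ℂ))
    (fun T w => ⟨w.1.1, ∑ ij : Fin T.1 × Fin T.2.1, w.2 ij •
      (T.2.2.1.frame ⟨w.1.1, w.1.2.1⟩ ij.1 ⊗ₜ[ℂ] T.2.2.2.frame ⟨w.1.1, w.1.2.2⟩ ij.2)⟩)

/-- The determinant `Λ^r E` of a vector bundle `E` of rank `r`; `u_1 ∧ … ∧ u_r` is a local frame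
if `u` is. -/
def det [HolSpace B] (E : LinearSpace B) (r : ℕ) : LinearSpace B where
  fib b := ⋀[ℂ]^r (E.fib b)
  hol := final (Z := fun T : LocTriv E r => T.W × ℂ)
    (fun T w => ⟨w.1.1, w.2 • exteriorPower.ιMulti ℂ r (T.frame w.1)⟩)

/-- The bundle `ℙ(E)` of lines in the fibers of `E`. -/
def PTot (E : LinearSpace B) : Type := Σ b, Projectivization ℂ (E.fib b)

/-- The projection from the complement of the zero section to `ℙ(E)`. -/
def toPTot (E : LinearSpace B) (p : {p : E.Tot // p.2 ≠ 0}) : E.PTot :=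
  ⟨p.1.1, Projectivization.mk ℂ p.1.2 p.2⟩

/-- `ℙ(E)` is the quotient of the complement of the zero section. -/
instance (E : LinearSpace B) : HolSpace E.PTot := final fun _ : Unit => E.toPTot

end LinearSpace

/-! ## Affine cones over projective varieties -/

namespace AffCone

variable {N : ℕ}

/-- The affine cone in `ℂ^(N+1)` over a subset of projective space. -/
def coneSet (Y : Set (Projectivization ℂ (Fin (N + 1) → ℂ))) : Set (Fin (N + 1) → ℂ) :=
  {x | ∀ h : x ≠ 0, Projectivization.mk ℂ x h ∈ Y}

/-- The homogeneous coordinate ring of `Y`, which is the coordinate ring of the affine cone. -/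
abbrev CoordRing (Y : Set (Projectivization ℂ (Fin (N + 1) → ℂ))) : Type :=
  MvPolynomial (Fin (N + 1)) ℂ ⧸ MvPolynomial.vanishingIdeal ℂ (coneSet Y)

/-- The Zariski tangent space of the affine cone over `Y` at `x`. -/
def tangentSpace (Y : Set (Projectivization ℂ (Fin (N + 1) → ℂ))) (x : Fin (N + 1) → ℂ) :
    Submodule ℂ (Fin (N + 1) → ℂ) where
  carrier := {v | ∀ p ∈ MvPolynomial.vanishingIdeal ℂ (coneSet Y),
    ∑ i, MvPolynomial.eval x (MvPolynomial.pderiv i p) * v i = 0}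
  add_mem' := by
    intro v w hv hw p hp
    simp [mul_add, Finset.sum_add_distrib, hv p hp, hw p hp]
  zero_mem' := by
    intro p _
    simp
  smul_mem' := by
    intro c v hv p hp
    have h : ∀ i, MvPolynomial.eval x (MvPolynomial.pderiv i p) * (c • v) i
        = c * (MvPolynomial.eval x (MvPolynomial.pderiv i p) * v i) := by
      intro i
      simp only [Pi.smul_apply, smul_eq_mul]
      ring
    simp only [h, ← Finset.mul_sum, hv p hp, mul_zero]

/-- `Y` is a smooth projective variety: a nonempty irreducible Zariski closed subset of projective
space, satisfying the Jacobian criterion (at the points of the affine cone outside of the vertex,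
which is equivalent to the criterion on `Y`). -/
structure IsSmoothProjectiveVariety (Y : Set (Projectivization ℂ (Fin (N + 1) → ℂ))) : Prop where
  nonempty : Y.Nonempty
  closed : ∃ S : Set (MvPolynomial (Fin (N + 1)) ℂ), (∀ p ∈ S, ∃ k, p.IsHomogeneous k) ∧
    ∀ (x : Fin (N + 1) → ℂ) (hx : x ≠ 0),
      Projectivization.mk ℂ x hx ∈ Y ↔ ∀ p ∈ S, MvPolynomial.eval x p = 0
  irreducible : (MvPolynomial.vanishingIdeal ℂ (coneSet Y)).IsPrime
  smooth : ∀ x ∈ coneSet Y, x ≠ 0 →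
    ((Module.finrank ℂ (tangentSpace Y x) : ℕ) : WithBot ℕ∞) = ringKrullDim (CoordRing Y)

variable (Y : Set (Projectivization ℂ (Fin (N + 1) → ℂ)))

/-- The affine cone `X` over `Y`, with the structure of a subspace of `ℂ^(N+1)`. -/
abbrev Cone : Type := {x : Fin (N + 1) → ℂ // x ∈ coneSet Y}

/-- The vertex `P` of the cone. -/
def vertex : Cone Y := ⟨0, fun h => absurd rfl h⟩

/-- `U = X - P`. -/
abbrev Punctured : Type := {x : Cone Y // x ≠ vertex Y}

variable {Y}

theorem Punctured.ne_zero (x : Punctured Y) : x.1.1 ≠ 0 := fun h => x.2 (Subtype.ext h)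

theorem smul_mem_coneSet (c : ℂˣ) {x : Fin (N + 1) → ℂ} (hx : x ∈ coneSet Y) :
    c • x ∈ coneSet Y := by
  intro h
  have hx0 : x ≠ 0 := by
    rintro rfl
    exact h (smul_zero c)
  have : Projectivization.mk ℂ (c • x) h = Projectivization.mk ℂ x hx0 :=
    (Projectivization.mk_eq_mk_iff ℂ _ _ h hx0).2 ⟨c, rfl⟩
  rw [this]
  exact hx hx0

/-- The action of `ℂ^*` on `X`. -/
instance : MulAction ℂˣ (Cone Y) where
  smul c x := ⟨c • x.1, smul_mem_coneSet c x.2⟩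
  one_smul x := Subtype.ext (one_smul _ x.1)
  mul_smul a b x := Subtype.ext (mul_smul a b x.1)

/-- The action of `ℂ^*` on `U`. -/
instance : MulAction ℂˣ (Punctured Y) where
  smul c x := ⟨c • x.1, fun h => x.ne_zero (by
    have h2 : c • x.1.1 = 0 := congrArg Subtype.val h
    exact (smul_eq_zero_iff_eq c).1 h2)⟩
  one_smul x := Subtype.ext (one_smul _ x.1)
  mul_smul a b x := Subtype.ext (mul_smul a b x.1)

/-- The projection `U → Y`. -/
def proj (x : Punctured Y) : Y := ⟨Projectivization.mk ℂ x.1.1 x.ne_zero, x.1.2 x.ne_zero⟩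

/-- The complex structure of `Y` as the quotient of `U`. -/
instance : HolSpace Y := final fun _ : Unit => (proj : Punctured Y → Y)

theorem proj_eq_iff (x x' : Punctured Y) : proj x = proj x' ↔ ∃ c : ℂˣ, x' = c • x := by
  constructor
  · intro h
    obtain ⟨c, hc⟩ := (Projectivization.mk_eq_mk_iff ℂ _ _ x'.ne_zero x.ne_zero).1
      (congrArg Subtype.val h.symm)
    exact ⟨c, Subtype.ext (Subtype.ext hc.symm)⟩
  · rintro ⟨c, rfl⟩
    exact (Subtype.ext ((Projectivization.mk_eq_mk_iff ℂ _ _ (c • x).ne_zero x.ne_zero).2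
      ⟨c, rfl⟩)).symm

theorem smul_inj (x : Punctured Y) {a b : ℂˣ} (h : a • x = b • x) : a = b := by
  have h1 : (a : ℂ) • x.1.1 = (b : ℂ) • x.1.1 := congrArg (fun z : Punctured Y => z.1.1) h
  exact Units.ext (smul_left_injective ℂ x.ne_zero h1)

/-- `f` is homogeneous of degree `d`. -/
def IsHomogeneous (f : Cone Y → ℂ) (d : ℤ) : Prop :=
  ∀ (c : ℂˣ) (x : Cone Y), f (c • x) = (c : ℂ) ^ d * f x

variable (Y) in
/-- The fiber over `y` of the quotient of `U × ℂ` by the action `c (x, t) = (c x, c ^ e t)`. The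
orbit of `(x, t)` is recorded as the equivariant function on the orbit of `x` of which it is the
graph. -/
def lineFib (e : ℤ) (y : Y) : Submodule ℂ ({x : Punctured Y // proj x = y} → ℂ) where
  carrier := {φ | ∀ (c : ℂˣ) (x x' : {x : Punctured Y // proj x = y}),
    x'.1 = c • x.1 → φ x' = (c : ℂ) ^ e * φ x}
  add_mem' := by
    intro φ ψ hφ hψ c x x' h
    simp only [Pi.add_apply, hφ c x x' h, hψ c x x' h, mul_add]
  zero_mem' := by
    intro c x x' _
    simp
  smul_mem' := by
    intro a φ hφ c x x' h
    simp only [Pi.smul_apply, smul_eq_mul, hφ c x x' h]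
    ring

/-- The orbit of `(x, t)`. -/
def orbit (e : ℤ) (x : Punctured Y) (t : ℂ) : lineFib Y e (proj x) :=
  ⟨fun x' => ((((proj_eq_iff x x'.1).1 x'.2.symm).choose : ℂˣ) : ℂ) ^ e * t, by
    intro c x' x'' h
    have h1 := ((proj_eq_iff x x'.1).1 x'.2.symm).choose_spec
    have h2 := ((proj_eq_iff x x''.1).1 x''.2.symm).choose_spec
    set a := ((proj_eq_iff x x'.1).1 x'.2.symm).choose
    set b := ((proj_eq_iff x x''.1).1 x''.2.symm).choose
    have h3 : b = c * a := smul_inj x (by rw [← h2, h, h1, mul_smul])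
    change (b : ℂ) ^ e * t = (c : ℂ) ^ e * ((a : ℂ) ^ e * t)
    rw [h3, Units.val_mul, mul_zpow, mul_assoc]⟩

theorem orbit_apply (e : ℤ) (x : Punctured Y) (t : ℂ) (c : ℂˣ)
    (x' : {x' : Punctured Y // proj x' = proj x}) (h : x'.1 = c • x) :
    (orbit e x t).1 x' = (c : ℂ) ^ e * t := by
  have h1 := ((proj_eq_iff x x'.1).1 x'.2.symm).choose_spec
  have h3 := smul_inj x (h1.symm.trans h)
  change ((((proj_eq_iff x x'.1).1 x'.2.symm).choose : ℂˣ) : ℂ) ^ e * t = _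
  rw [h3]

/-- The quotient map from `U × ℂ` to the total space of `H_Y^e`. -/
def orbitMap (e : ℤ) (p : Punctured Y × ℂ) : Σ y : Y, lineFib Y e y := ⟨proj p.1, orbit e p.1 p.2⟩

variable (Y) in
/-- The line bundle `H_Y^e`: the quotient of `U × ℂ` by the action `c (x, t) = (c x, c ^ e t)`. -/
abbrev lineBundle (e : ℤ) : LinearSpace Y where
  fib y := lineFib Y e y
  hol := final fun _ : Unit => (orbitMap e : Punctured Y × ℂ → _)

theorem orbitMap_surjective (e : ℤ) :
    Function.Surjective (orbitMap e : Punctured Y × ℂ → Σ y : Y, lineFib Y e y) := by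
  rintro ⟨y, φ⟩
  obtain ⟨x, rfl⟩ : ∃ x : Punctured Y, proj x = y := by
    obtain ⟨y, hy⟩ := y
    induction y using Projectivization.ind with
    | h v hv => exact ⟨⟨⟨v, fun _ => hy⟩, fun h => hv (congrArg Subtype.val h)⟩, rfl⟩
  refine ⟨(x, φ.1 ⟨x, rfl⟩), ?_⟩
  refine Sigma.ext rfl (heq_of_eq (Subtype.ext (funext fun x' => ?_)))
  obtain ⟨c, hc⟩ := (proj_eq_iff x x'.1).1 x'.2.symm
  exact (orbit_apply e x _ c x' hc).trans (φ.2 c ⟨x, rfl⟩ x' hc).symm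

/-- The points of `H_Y^e` are exactly the orbits of the action on `U × ℂ`. -/
theorem orbitMap_eq_iff (e : ℤ) (p p' : Punctured Y × ℂ) :
    orbitMap e p = orbitMap e p' ↔ ∃ c : ℂˣ, p' = (c • p.1, (c : ℂ) ^ e * p.2) := by
  obtain ⟨x, t⟩ := p
  obtain ⟨x', t'⟩ := p'
  have key : ∀ (y y' : Y) (φ : lineFib Y e y) (φ' : lineFib Y e y') (z : Punctured Y)
      (h : proj z = y) (h' : proj z = y'),
      (⟨y, φ⟩ : Σ y : Y, lineFib Y e y) = ⟨y', φ'⟩ → φ.1 ⟨z, h⟩ = φ'.1 ⟨z, h'⟩ := by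
    intro y y' φ φ' z h h' heq
    cases heq
    rfl
  have self : ∀ (z : Punctured Y) (s : ℂ), (orbit e z s).1 ⟨z, rfl⟩ = s := fun z s => by
    rw [orbit_apply e z s 1 ⟨z, rfl⟩ (one_smul _ z).symm]
    simp
  constructor
  · intro h
    have h1 : proj x = proj x' := congrArg Sigma.fst h
    obtain ⟨c, rfl⟩ := (proj_eq_iff x x').1 h1
    refine ⟨c, Prod.ext rfl ?_⟩
    have h2 := key _ _ _ _ (c • x) h1.symm rfl h
    rw [self, orbit_apply e x t c _ rfl] at h2
    exact h2.symm
  · rintro ⟨c, h⟩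
    cases h
    have h1 : proj x = proj (c • x) := (proj_eq_iff _ _).2 ⟨c, rfl⟩
    obtain ⟨⟨z, s⟩, hz⟩ := orbitMap_surjective e (orbitMap e (x, t))
    have hzx : proj z = proj x := congrArg Sigma.fst hz
    have ext : ∀ (y y' : Y) (hy : y = y') (φ : lineFib Y e y) (φ' : lineFib Y e y'),
        (∀ (w : Punctured Y) (h : proj w = y) (h' : proj w = y'), φ.1 ⟨w, h⟩ = φ'.1 ⟨w, h'⟩) →
        (⟨y, φ⟩ : Σ y : Y, lineFib Y e y) = ⟨y', φ'⟩ := by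
      rintro y _ rfl φ φ' hφ
      exact Sigma.ext rfl (heq_of_eq (Subtype.ext (funext fun w => hφ w.1 w.2 w.2)))
    refine ext _ _ h1 _ _ fun w hw hw' => ?_
    obtain ⟨a, ha⟩ := (proj_eq_iff (c • x) w).1 hw'.symm
    rw [orbit_apply e (c • x) _ a ⟨w, hw'⟩ ha,
      orbit_apply e x t (a * c) ⟨w, hw⟩ (by rw [mul_smul]; exact ha)]
    rw [Units.val_mul, mul_zpow, mul_assoc]

/-- A homogeneous function of degree `d` as a homomorphism `H_Y^e → H_Y^m`, where `d + e = m`; it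
maps the orbit of `(x, t)` to the orbit of `(x, f(x) t)`. -/
def mulHom (f : Cone Y → ℂ) {d e m : ℤ} (hf : IsHomogeneous f d) (h : d + e = m) (y : Y) :
    (lineBundle Y e).fib y →ₗ[ℂ] (lineBundle Y m).fib y where
  toFun φ := ⟨fun x => f x.1.1 * φ.1 x, by
    intro c x x' hx
    have h1 : x'.1.1 = c • x.1.1 := congrArg Subtype.val hx
    have h2 : (c : ℂ) ^ m = (c : ℂ) ^ d * (c : ℂ) ^ e := by rw [← h, zpow_add₀ c.ne_zero]
    change f x'.1.1 * φ.1 x' = (c : ℂ) ^ m * (f x.1.1 * φ.1 x)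
    rw [h1, hf c x.1.1, φ.2 c x x' hx, h2]
    ring⟩
  map_add' φ ψ := Subtype.ext (funext fun x => mul_add (f x.1.1) (φ.1 x) (ψ.1 x))
  map_smul' a φ := Subtype.ext (funext fun x => mul_left_comm (f x.1.1) a (φ.1 x))

section syzygy

variable {n : ℕ} (f : Fin n → Cone Y → ℂ) {d e : Fin n → ℤ} {m : ℤ}
  (hf : ∀ i, IsHomogeneous (f i) (d i)) (h : ∀ i, d i + e i = m)

variable (Y) in
/-- `H_Y^{e_1} ×_Y … ×_Y H_Y^{e_n}`. -/
abbrev sumBundle (e : Fin n → ℤ) : LinearSpace Y := LinearSpace.prod fun i => lineBundle Y (e i)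

/-- The homomorphism `∑ f_i : H_Y^{e_1} ×_Y … ×_Y H_Y^{e_n} → H_Y^m`. -/
def sumHom (y : Y) : (sumBundle Y e).fib y →ₗ[ℂ] (lineBundle Y m).fib y :=
  ∑ i, (mulHom (f i) (hf i) (h i) y).comp (LinearMap.proj i)

/-- The bundle `V_m`, the kernel of `∑ f_i`. -/
abbrev syzBundle : LinearSpace Y := LinearSpace.ker (sumHom f hf h)

/-- `V(f_1 t_1 + … + f_n t_n)|_U`, a subspace of `U × ℂ^n`. -/
abbrev relSpace : Type := {p : Punctured Y × (Fin n → ℂ) // ∑ i, f i p.1.1 * p.2 i = 0}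

/-- The action `c (x, t_1, …, t_n) = (c x, c ^ e_1 t_1, …, c ^ e_n t_n)` of `ℂ^*` on
`V(f_1 t_1 + … + f_n t_n)|_U`. -/
abbrev relAction : MulAction ℂˣ (relSpace f) where
  smul c p := ⟨(c • p.1.1, fun i => (c : ℂ) ^ e i * p.1.2 i), by
    have h1 : ∀ i, f i (c • p.1.1.1) * ((c : ℂ) ^ e i * p.1.2 i)
        = (c : ℂ) ^ m * (f i p.1.1.1 * p.1.2 i) := by
      intro i
      rw [hf i c p.1.1.1, ← h i, zpow_add₀ c.ne_zero]
      ring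
    change ∑ i, f i (c • p.1.1.1) * ((c : ℂ) ^ e i * p.1.2 i) = 0
    rw [Finset.sum_congr rfl fun i _ => h1 i, ← Finset.mul_sum, p.2, mul_zero]⟩
  one_smul p := by
    refine Subtype.ext (Prod.ext (one_smul ℂˣ p.1.1) (funext fun i => ?_))
    change ((1 : ℂˣ) : ℂ) ^ e i * p.1.2 i = p.1.2 i
    simp
  mul_smul a b p := by
    refine Subtype.ext (Prod.ext (mul_smul a b p.1.1) (funext fun i => ?_))
    change ((a * b : ℂˣ) : ℂ) ^ e i * p.1.2 i = (a : ℂ) ^ e i * ((b : ℂ) ^ e i * p.1.2 i)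
    rw [Units.val_mul, mul_zpow, mul_assoc]

/-- The map from `V(f_1 t_1 + … + f_n t_n)|_U` to `V_m` which maps `(x, t_1, …, t_n)` to the
tuple of the orbits of the `(x, t_i)`. -/
def relQuot (p : relSpace f) : (syzBundle f hf h).Tot :=
  ⟨proj p.1.1, ⟨fun i => orbit (e i) p.1.1 (p.1.2 i), by
    refine Subtype.ext (funext fun x => ?_)
    obtain ⟨c, hc⟩ := (proj_eq_iff p.1.1 x.1).1 x.2.symm
    have h0 : (sumHom f hf h (proj p.1.1) fun i => orbit (e i) p.1.1 (p.1.2 i)).1 x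
        = ∑ i, f i x.1.1 * (orbit (e i) p.1.1 (p.1.2 i)).1 x := by
      simp only [sumHom, LinearMap.sum_apply]
      refine (congrFun (map_sum (lineFib Y m (proj p.1.1)).subtype
        (fun i => mulHom (f i) (hf i) (h i) (proj p.1.1) (orbit (e i) p.1.1 (p.1.2 i)))
        Finset.univ) x).trans ?_
      rw [Finset.sum_apply]
      rfl
    refine h0.trans ?_
    have h1 : ∀ i, f i x.1.1 * (orbit (e i) p.1.1 (p.1.2 i)).1 x
        = (c : ℂ) ^ m * (f i p.1.1.1 * p.1.2 i) := by
      intro i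
      have hx : x.1.1 = c • p.1.1.1 := congrArg Subtype.val hc
      rw [orbit_apply _ _ _ c x hc, hx, hf i c, ← h i, zpow_add₀ c.ne_zero]
      ring
    rw [Finset.sum_congr rfl fun i _ => h1 i, ← Finset.mul_sum, p.2, mul_zero]
    rfl⟩⟩

end syzygy

end AffCone

end

/-!
Everything is reduced to coordinates. On the chart of `Y` where a homogeneous coordinate does not
vanish, normalizing this coordinate to `1` gives a holomorphic section `σ` of `U → Y`. An element of
the fiber of `H_Y^e` over `y` is an equivariant function on the orbit over `y`, so it is determined
by its value at `σ y`, and a map to `H_Y^e` is holomorphic iff its base point and this value are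
(`LocSec.holMapAt_line`). The structures of the fiber product and of the kernel are initial, so the
same criterion, now with `n` values, holds for `H_Y^{e_1} ×_Y … ×_Y H_Y^{e_n}` and for `V_m`
(`LocSec.holMapAt_sum`, `LocSec.holMapAt_syz`). After this, each map in the proposition has to be
written in coordinates only.

* Local triviality of `V_m`: the `f_i` have no common zero on `U`, and where `f_i ≠ 0` the equation
  `∑ f_k t_k = 0` is solved for `t_i` (`syzTriv`).
* The quotient: a holomorphic surjection with local holomorphic sections, whose fibers are the
  orbits, is the quotient (`isQuotient_of_sections`); the section `σ` of `U → Y` induces one of the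
  map to `V_m`.
* The determinant: `v_1 ∧ … ∧ v_r` is mapped to the function `x ↦ det (t, v_1(x), …, v_r(x))`,
  where `∑ f_i(x) t_i = 1`. Two choices of `t` differ by a vector of the hyperplane
  `∑ f_i(x) t_i = 0`, which also contains the `r` vectors `v_a(x)` and has dimension `r`, so the
  choice does not matter (`det_vecCons_congr`). The `i`-th column has weight `e_i` and `t` is
  rescaled by the weight `-m`, so the function has weight `∑ e_i - m` (`detForm_smul`). Where
  `f_i ≠ 0`, the choice of `t` as a multiple of the `i`-th unit vector shows that it is holomorphic.
* The twist: the actions for `m` and `m'` differ by the scalar factor `c ^ (m' - m)`, because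
  `e'_i - e_i = m' - m` (`syzCast_smul`). This gives both the isomorphism with the tensor product
  and the isomorphism of the projective bundles.

The structures of `E ⊗ F`, `Λ^r E` and `ℙ(E)` are final, so a map from them is holomorphic as soon
as its composites with the charts are; maps into them are written through a chart or a local lift.
-/

noncomputable section

namespace HolSpace

/-! ### Germs of holomorphic maps -/

variable {A B Z : Type} [HolSpace A] [HolSpace B] [HolSpace Z]

/-- The neighbourhood filter of a point of a complex space. -/
def nb (x : Z) : Filter Z := @nhds Z top x

/-- Holomorphy at a point of a map that need not be holomorphic elsewhere: continuity at the point,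
and germs of holomorphic functions pull back to such germs. -/
def HolMapAt (φ : A → B) (a : A) : Prop :=
  Filter.Tendsto φ (nb a) (nb (φ a)) ∧ ∀ g : B → ℂ, HolAt g (φ a) → HolAt (g ∘ φ) a

theorem nb_self {P : Z → Prop} {x : Z} (h : ∀ᶠ z in nb x, P z) : P x :=
  let _ : TopologicalSpace Z := top
  Filter.Eventually.self_of_nhds h

theorem nb_of_isOpen {W : Set Z} (hW : IsOpen[top] W) {x : Z} (hx : x ∈ W) :
    ∀ᶠ z in nb x, z ∈ W :=
  let _ : TopologicalSpace Z := top
  hW.mem_nhds hx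

theorem isOpen_of_nb {W : Set Z} (h : ∀ x ∈ W, ∀ᶠ z in nb x, z ∈ W) : IsOpen[top] W :=
  let _ : TopologicalSpace Z := top
  isOpen_iff_mem_nhds.2 h

theorem holMap_iff {φ : A → B} : HolMap φ ↔ ∀ a, HolMapAt φ a := by
  constructor
  · exact fun h a => ⟨(@Continuous.continuousAt A B top top φ a h.1), h.2 a⟩
  · exact fun h => ⟨(@continuous_iff_continuousAt A B top top φ).2 fun a => (h a).1,
      fun a => (h a).2⟩

theorem HolMap.at {φ : A → B} (h : HolMap φ) (a : A) : HolMapAt φ a := holMap_iff.1 h a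

theorem HolMapAt.comp {ψ : B → Z} {φ : A → B} {a : A} (hψ : HolMapAt ψ (φ a))
    (hφ : HolMapAt φ a) : HolMapAt (fun z => ψ (φ z)) a :=
  ⟨hψ.1.comp hφ.1, fun g hg => hφ.2 _ (hψ.2 g hg)⟩

theorem HolMap.comp {ψ : B → Z} {φ : A → B} (hψ : HolMap ψ) (hφ : HolMap φ) :
    HolMap (fun z => ψ (φ z)) :=
  holMap_iff.2 fun a => (hψ.at _).comp (hφ.at a)

theorem HolMapAt.congr {φ ψ : A → B} {a : A} (h : HolMapAt φ a) (e : ∀ᶠ z in nb a, φ z = ψ z) :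
    HolMapAt ψ a := by
  refine ⟨?_, fun g hg => ?_⟩
  · rw [← nb_self e]
    exact h.1.congr' e
  · rw [← nb_self e] at hg
    exact hol_congr (e.mono fun z hz => congrArg g hz) (h.2 g hg)

theorem holMapAt_id (a : A) : HolMapAt (fun z => z) a := ⟨Filter.tendsto_id, fun _ h => h⟩

theorem HolMapAt.eventually {φ : A → B} {a : A} (h : HolMapAt φ a) {P : B → Prop}
    (hP : ∀ᶠ z in nb (φ a), P z) : ∀ᶠ z in nb a, P (φ z) := h.1.eventually hP

/-! ### Holomorphic functions -/

theorem holAt_const (c : ℂ) (a : A) : HolAt (fun _ : A => c) a :=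
  hol_comp (κ := Empty) (g := fun k => k.elim) (G := fun _ => c) (fun k => k.elim) analyticAt_const

theorem analyticAt_coord {κ : Type} [Fintype κ] (k : κ) (v : κ → ℂ) :
    AnalyticAt ℂ (fun v : κ → ℂ => v k) v :=
  (ContinuousLinearMap.proj (R := ℂ) (φ := fun _ : κ => ℂ) k).analyticAt v

theorem HolAt.mul {g h : A → ℂ} {a : A} (hg : HolAt g a) (hh : HolAt h a) :
    HolAt (fun z => g z * h z) a :=
  hol_comp (κ := Bool) (g := fun b => cond b g h) (G := fun v => v true * v false)
    (fun b => by cases b <;> assumption) ((analyticAt_coord _ _).mul (analyticAt_coord _ _))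

theorem HolAt.comp_one {g : A → ℂ} {G : ℂ → ℂ} {a : A} (hg : HolAt g a)
    (hG : AnalyticAt ℂ G (g a)) : HolAt (fun z => G (g z)) a :=
  hol_comp (κ := Unit) (g := fun _ => g) (G := fun v => G (v ())) (fun _ => hg)
    (AnalyticAt.comp (g := G) (f := fun v : Unit → ℂ => v ()) hG (analyticAt_coord _ _))

theorem HolAt.zpow {g : A → ℂ} {a : A} (hg : HolAt g a) (h0 : g a ≠ 0) (k : ℤ) :
    HolAt (fun z => g z ^ k) a :=
  hg.comp_one (G := fun w => w ^ k) (AnalyticAt.zpow analyticAt_id h0)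

theorem HolAt.inv {g : A → ℂ} {a : A} (hg : HolAt g a) (h0 : g a ≠ 0) :
    HolAt (fun z => (g z)⁻¹) a :=
  hg.comp_one (G := fun w => w⁻¹) (analyticAt_id.inv h0)

theorem HolAt.sum {κ : Type} [Fintype κ] {g : κ → A → ℂ} {a : A} (hg : ∀ k, HolAt (g k) a) :
    HolAt (fun z => ∑ k, g k z) a :=
  hol_comp (G := fun v => ∑ k, v k) hg
    (Finset.analyticAt_fun_sum _ fun k _ => analyticAt_coord k _)

theorem HolAt.prod {κ : Type} [Fintype κ] {g : κ → A → ℂ} {a : A} (hg : ∀ k, HolAt (g k) a) :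
    HolAt (fun z => ∏ k, g k z) a :=
  hol_comp (G := fun v => ∏ k, v k) hg
    (Finset.analyticAt_fun_prod _ fun k _ => analyticAt_coord k _)

theorem HolAt.matrix_det {k : ℕ} {M : A → Matrix (Fin k) (Fin k) ℂ} {a : A}
    (hM : ∀ i j, HolAt (fun z => M z i j) a) : HolAt (fun z => (M z).det) a := by
  simp only [Matrix.det_apply']
  exact HolAt.sum fun σ => (holAt_const _ a).mul (HolAt.prod fun i => hM _ _)

theorem HolAt.eventually_ne {g : A → ℂ} {a : A} (hg : HolAt g a) (h0 : g a ≠ 0) :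
    ∀ᶠ z in nb a, g z ≠ 0 :=
  (show Filter.Tendsto g (nb a) (𝓝 (g a)) from hol_continuousAt hg).eventually_ne h0

theorem holMapAt_complex {φ : A → ℂ} {a : A} : HolMapAt φ a ↔ HolAt φ a := by
  constructor
  · exact fun h => h.2 id analyticAt_id
  · exact fun h => ⟨hol_continuousAt h, fun g hg => h.comp_one hg⟩

theorem holMapAt_pi {κ : Type} [Fintype κ] {φ : A → κ → ℂ} {a : A} :
    HolMapAt φ a ↔ ∀ k, HolAt (fun z => φ z k) a := by
  constructor
  · exact fun h k => h.2 (fun v => v k) (analyticAt_coord k _)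
  · refine fun h => ⟨?_, fun g hg => hol_comp (g := fun k z => φ z k) h hg⟩
    exact tendsto_pi_nhds.2 fun k => hol_continuousAt (h k)

/-! ### Initial structures: subspaces and products -/

theorem nb_initial {T : Type} {ι : Type} (p : ι → Target T) (x : T) :
    @nb T (initial p) x = ⨅ i, Filter.comap (p i).map (nb ((p i).map x)) := by
  refine (nhds_iInf (t := fun i => TopologicalSpace.induced (p i).map top) (a := x)).trans ?_
  refine iInf_congr fun i => ?_
  let _ : TopologicalSpace (p i).Z := top
  exact nhds_induced (p i).map x

theorem holMap_of_initial {T : Type} {ι : Type} (p : ι → Target T) (i : ι) :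
    @HolMap T (p i).Z (initial p) _ (p i).map := by
  let _ := initial p
  refine holMap_iff.2 fun a => ⟨?_, fun g hg => ?_⟩
  · exact Filter.tendsto_iff_comap.2 ((nb_initial p a).trans_le (iInf_le _ i))
  · refine ⟨Unit, inferInstance, fun _ => i, fun _ => g, fun v => v (), fun _ => hg,
      analyticAt_coord _ _, Filter.Eventually.of_forall fun z => rfl⟩

/-- The universal property of the initial structure, at a point. -/
theorem holMapAt_initial {T : Type} {ι : Type} (p : ι → Target T) {φ : A → T} {a : A} :
    @HolMapAt A T _ (initial p) φ a ↔ ∀ i, HolMapAt (fun z => (p i).map (φ z)) a := by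
  let _ := initial p
  constructor
  · exact fun h i => HolMapAt.comp ((holMap_of_initial p i).at (φ a)) h
  · intro h
    have h1 : Filter.Tendsto φ (nb a) (nb (φ a)) :=
      (Filter.tendsto_iInf.2 fun i => Filter.tendsto_comap_iff.2 (h i).1).trans
        (nb_initial p (φ a)).ge
    refine ⟨h1, ?_⟩
    rintro f ⟨κ, hκ, i, g, G, hg, hG, hf⟩
    exact hol_congr (Filter.Eventually.mono (h1.eventually hf) fun z hz => hz.symm)
      (hol_comp (g := fun k z => g k ((p (i k)).map (φ z))) (fun k => (h (i k)).2 _ (hg k)) hG)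

theorem holMap_val (P : Z → Prop) : HolMap (Subtype.val : Subtype P → Z) :=
  holMap_of_initial (fun _ : Unit => ⟨Subtype.val⟩) ()

theorem holMapAt_subtype {P : Z → Prop} {φ : A → Subtype P} {a : A} :
    HolMapAt φ a ↔ HolMapAt (fun z => (φ z).1) a :=
  (holMapAt_initial (fun _ : Unit => ⟨Subtype.val⟩)).trans ⟨fun h => h (), fun h _ => h⟩

theorem holMap_fst : HolMap (Prod.fst : A × B → A) :=
  holMap_of_initial ![⟨Prod.fst⟩, ⟨Prod.snd⟩] 0

theorem holMap_snd : HolMap (Prod.snd : A × B → B) :=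
  holMap_of_initial ![⟨Prod.fst⟩, ⟨Prod.snd⟩] 1

theorem holMapAt_prod {φ : Z → A × B} {z : Z} :
    HolMapAt φ z ↔ HolMapAt (fun w => (φ w).1) z ∧ HolMapAt (fun w => (φ w).2) z :=
  (holMapAt_initial ![⟨Prod.fst⟩, ⟨Prod.snd⟩]).trans (Fin.forall_fin_two)

/-- A map into `Z` that takes values in the subspace `P` near a point, as a map into `P`; elsewhere
it has the junk value `c`. -/
def near (P : Z → Prop) (c : Subtype P) (φ : A → Z) (z : A) : Subtype P := by
  classical exact if h : P (φ z) then ⟨φ z, h⟩ else c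

theorem near_val {α γ : Type} {P : γ → Prop} (c : Subtype P) {φ : α → γ} {z : α} (h : P (φ z)) :
    near P c φ z = ⟨φ z, h⟩ := dif_pos h

theorem HolMapAt.near {P : Z → Prop} {c : Subtype P} {φ : A → Z} {a : A} (h : HolMapAt φ a)
    (hP : ∀ᶠ z in nb a, P (φ z)) : HolMapAt (near P c φ) a :=
  holMapAt_subtype.2 (h.congr (hP.mono fun z hz => by rw [near_val c hz]))

/-! ### Final structures: quotients -/

theorem holMap_to_final {T : Type} {ι : Type*} {Z : ι → Type} [∀ i, HolSpace (Z i)]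
    (q : ∀ i, Z i → T) (i : ι) : @HolMap (Z i) T _ (final q) (q i) := by
  let _ := final q
  let _ : TopologicalSpace (Z i) := top
  refine ⟨continuous_iff_coinduced_le.2 (le_iSup
    (fun i => TopologicalSpace.coinduced (q i) top) i), ?_⟩
  rintro a g ⟨O, hO, ha, hg⟩
  exact hg i a ha

/-- The universal property of the final structure. -/
theorem holMap_from_final {T : Type} {ι : Type*} {Z : ι → Type} [∀ i, HolSpace (Z i)]
    (q : ∀ i, Z i → T) {φ : T → B} (h : ∀ i, HolMap (fun z => φ (q i z))) :
    @HolMap T B (final q) _ φ := by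
  let _ := final q
  have hc : @Continuous T B top top φ :=
    continuous_iSup_dom.2 fun i => continuous_coinduced_dom.2 (h i).1
  refine ⟨hc, fun a g hg => ?_⟩
  obtain ⟨O, hO, hO', ha⟩ := (@eventually_nhds_iff B top _ _).1 (hol_eventually hg)
  exact ⟨φ ⁻¹' O, @IsOpen.preimage T B top top φ hc O hO', ha, fun i z hz => (h i).2 z g (hO _ hz)⟩

theorem isOpen_final {T : Type} {ι : Type*} {Z : ι → Type} [∀ i, HolSpace (Z i)]
    (q : ∀ i, Z i → T) {O : Set T} :
    IsOpen[(final q).top] O ↔ ∀ i, IsOpen[top] (q i ⁻¹' O) :=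
  isOpen_iSup_iff (t := fun i => TopologicalSpace.coinduced (q i) top)

theorem holAt_final {T : Type} {ι : Type*} {Z : ι → Type} [∀ i, HolSpace (Z i)]
    (q : ∀ i, Z i → T) {g : T → ℂ} {p : T} (O : Set T) (hO : ∀ i, IsOpen[top] (q i ⁻¹' O))
    (hp : p ∈ O) (hg : ∀ i z, q i z ∈ O → HolAt (fun z => g (q i z)) z) :
    @HolAt T (final q) g p :=
  ⟨O, (isOpen_final q).2 hO, hp, hg⟩

/-- A holomorphic surjection with local holomorphic sections, whose fibers are the orbits of a
group action, is the quotient by this action. -/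
theorem isQuotient_of_sections {G Q : Type} [Group G] [MulAction G Z] [HolSpace Q]
    {q : Z → Q} (hq : HolMap q) (fiber : ∀ z z' : Z, q z = q z' ↔ ∃ c : G, z' = c • z)
    (sec : ∀ p : Q, ∃ s : Q → Z, (∀ p', q (s p') = p') ∧ HolMapAt s p) :
    IsQuotient G q where
  surjective p := let ⟨s, hs, _⟩ := sec p; ⟨s p, hs p⟩
  fiber := fiber
  isOpen O := by
    refine ⟨fun h => @IsOpen.preimage Z Q top top q hq.1 O h, fun h => isOpen_of_nb fun p hp => ?_⟩
    obtain ⟨s, hs, hsp⟩ := sec p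
    filter_upwards [hsp.eventually (nb_of_isOpen h (x := s p) (by rwa [Set.mem_preimage, hs]))]
      with p' hp'
    rwa [Set.mem_preimage, hs] at hp'
  hol O hO g := by
    refine ⟨fun h z hz => (hq.at z).2 g (h _ hz), fun h p hp => ?_⟩
    obtain ⟨s, hs, hsp⟩ := sec p
    have h1 := hsp.2 _ (h (s p) (by rwa [Set.mem_preimage, hs]))
    refine hol_congr (Filter.Eventually.of_forall fun p' => ?_) h1
    simp [hs]

end HolSpace

open HolSpace

namespace LinearSpace

/-! ### Local trivializations, tensor products and determinants -/

variable {B : Type} [HolSpace B] {E F : LinearSpace B} {r : ℕ}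

/-- Holomorphic coordinates on `E|_W` with a holomorphic inverse give a local trivialization. -/
def LocTriv.ofCoord (E : LinearSpace B) {r : ℕ} {W : Set B} (hW : IsOpen[top] W)
    (triv : ∀ b : W, E.fib b ≃ₗ[ℂ] (Fin r → ℂ)) (hE : HolMap (fun p : E.Tot => p.1))
    (coord : E.Tot → Fin r → ℂ) (hc : ∀ p : E.Tot, p.1 ∈ W → HolMapAt coord p)
    (hct : ∀ (b : W) (v : E.fib b), coord ⟨b, v⟩ = triv b v)
    (hi : HolMap (B := E.Tot) fun w : W × (Fin r → ℂ) => ⟨w.1.1, (triv w.1).symm w.2⟩) :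
    LocTriv E r where
  W := W
  isOpen := hW
  triv := triv
  bihol := by
    constructor
    · refine holMap_iff.2 fun p => holMapAt_prod.2 ⟨holMapAt_subtype.2 ?_, ?_⟩
      · exact (hE.at p.1).comp ((holMap_val _).at p)
      · have h1 : HolMapAt (fun p : {p : E.Tot // p.1 ∈ W} => coord p.1) p :=
          (hc p.1 p.2).comp ((holMap_val _).at p)
        exact h1.congr (Filter.Eventually.of_forall fun q => hct ⟨q.1.1, q.2⟩ q.1.2)
    · exact holMap_iff.2 fun w => holMapAt_subtype.2 (hi.at w)

/-- The inverse of a local trivialization is holomorphic. -/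
theorem LocTriv.holMap_symm (T : LocTriv E r) :
    HolMap (B := E.Tot) fun w : T.W × (Fin r → ℂ) => ⟨w.1.1, (T.triv w.1).symm w.2⟩ :=
  (holMap_val _).comp T.bihol.2

theorem LocTriv.holMap_frame (T : LocTriv E r) (i : Fin r) :
    HolMap (B := E.Tot) fun b : T.W => ⟨b.1, T.frame b i⟩ := by
  refine T.holMap_symm.comp (φ := fun b : T.W => (b, (Pi.single i 1 : Fin r → ℂ))) ?_
  exact holMap_iff.2 fun b => holMapAt_prod.2 ⟨holMapAt_id b, holMapAt_pi.2 fun k =>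
    holAt_const _ _⟩

theorem LocTriv.sum_frame (T : LocTriv E r) (b : T.W) (v : E.fib b) :
    ∑ i, T.triv b v i • T.frame b i = v := by
  apply (T.triv b).injective
  simp only [map_sum, map_smul, frame, LinearEquiv.apply_symm_apply]
  exact (pi_eq_sum_univ' _).symm

/-- The frame of a local trivialization as a basis of the fiber. -/
def LocTriv.basis (T : LocTriv E r) (b : T.W) : Module.Basis (Fin r) ℂ (E.fib b) :=
  Module.Basis.ofEquivFun (T.triv b)

theorem LocTriv.basis_apply (T : LocTriv E r) (b : T.W) (i : Fin r) :
    T.basis b i = T.frame b i := by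
  simp [basis, frame, Module.Basis.coe_ofEquivFun]

/-- The coordinates, with respect to a local trivialization, of a holomorphic family of vectors. -/
theorem LocTriv.exists_coord {A : Type} [HolSpace A] (T : LocTriv E r) {b : A → B}
    {v : ∀ a, E.fib (b a)} {a : A} (hv : HolMapAt (B := E.Tot) (fun z => ⟨b z, v z⟩) a)
    (hb : HolMapAt b a) (ha : b a ∈ T.W) :
    ∃ c : A → Fin r → ℂ, HolMapAt c a ∧
      ∀ z (h : b z ∈ T.W), v z = ∑ i, c z i • T.frame ⟨b z, h⟩ i := by
  have hW : ∀ᶠ z in nb a, b z ∈ T.W := hb.eventually (nb_of_isOpen T.isOpen ha)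
  let φ : A → {p : E.Tot // p.1 ∈ T.W} :=
    near (fun p : E.Tot => p.1 ∈ T.W) ⟨⟨b a, v a⟩, ha⟩ fun z => ⟨b z, v z⟩
  refine ⟨fun z => (trivEquiv E T.W T.triv (φ z)).2, ?_, fun z h => ?_⟩
  · exact (holMap_snd.at _).comp ((T.bihol.1.at (φ a)).comp (hv.near hW))
  · have h1 : φ z = ⟨⟨b z, v z⟩, h⟩ :=
      near_val (P := fun p : E.Tot => p.1 ∈ T.W) _ (φ := fun z => (⟨b z, v z⟩ : E.Tot)) h
    simp only [h1]
    exact (T.sum_frame ⟨b z, h⟩ (v z)).symm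

/-- The chart of `E ⊗ F` given by local trivializations of `E` and `F`. -/
def tensorChart {s : ℕ} (T : LocTriv E r) (S : LocTriv F s)
    (w : {b : B // b ∈ T.W ∧ b ∈ S.W} × (Fin r × Fin s → ℂ)) : (E.tensor F).Tot :=
  ⟨w.1.1, ∑ ij : Fin r × Fin s, w.2 ij •
    (T.frame ⟨w.1.1, w.1.2.1⟩ ij.1 ⊗ₜ[ℂ] S.frame ⟨w.1.1, w.1.2.2⟩ ij.2)⟩

theorem holMap_tensorChart {s : ℕ} (T : LocTriv E r) (S : LocTriv F s) :
    HolMap (tensorChart T S) :=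
  holMap_to_final (Z := fun T : Σ (r : ℕ) (s : ℕ), LocTriv E r × LocTriv F s =>
      {b : B // b ∈ T.2.2.1.W ∧ b ∈ T.2.2.2.W} × (Fin T.1 × Fin T.2.1 → ℂ))
    (fun T => tensorChart T.2.2.1 T.2.2.2) ⟨r, s, T, S⟩

theorem holMap_from_tensor {A : Type} [HolSpace A] {φ : (E.tensor F).Tot → A}
    (h : ∀ (r s : ℕ) (T : LocTriv E r) (S : LocTriv F s), HolMap fun w => φ (tensorChart T S w)) :
    HolMap φ :=
  holMap_from_final (Z := fun T : Σ (r : ℕ) (s : ℕ), LocTriv E r × LocTriv F s =>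
      {b : B // b ∈ T.2.2.1.W ∧ b ∈ T.2.2.2.W} × (Fin T.1 × Fin T.2.1 → ℂ))
    (fun T => tensorChart T.2.2.1 T.2.2.2) fun T => h T.1 T.2.1 T.2.2.1 T.2.2.2

/-- The chart of `Λ^r E` given by a local trivialization of `E`. -/
def detChart (T : LocTriv E r) (w : T.W × ℂ) : (E.det r).Tot :=
  ⟨w.1.1, w.2 • exteriorPower.ιMulti ℂ r (T.frame w.1)⟩

theorem holMap_detChart (T : LocTriv E r) : HolMap (detChart T) :=
  holMap_to_final (Z := fun T : LocTriv E r => T.W × ℂ) (fun T => detChart T) T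

theorem holMap_from_det {A : Type} [HolSpace A] {φ : (E.det r).Tot → A}
    (h : ∀ T : LocTriv E r, HolMap fun w => φ (detChart T w)) : HolMap φ :=
  holMap_from_final (Z := fun T : LocTriv E r => T.W × ℂ) (fun T => detChart T) h

/-- The tensor product of holomorphic families of vectors is holomorphic. -/
theorem holMapAt_tmul {A : Type} [HolSpace A] {s : ℕ} (hE : E.IsVectorBundle r)
    (hF : F.IsVectorBundle s) {b : A → B} {v : ∀ a, E.fib (b a)} {w : ∀ a, F.fib (b a)} {a : A}
    (hv : HolMapAt (B := E.Tot) (fun z => ⟨b z, v z⟩) a)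
    (hw : HolMapAt (B := F.Tot) (fun z => ⟨b z, w z⟩) a) (hb : HolMapAt b a) :
    HolMapAt (B := (E.tensor F).Tot) (fun z => ⟨b z, v z ⊗ₜ[ℂ] w z⟩) a := by
  obtain ⟨T, hT⟩ := hE (b a)
  obtain ⟨S, hS⟩ := hF (b a)
  obtain ⟨c, hc, hcv⟩ := T.exists_coord hv hb hT
  obtain ⟨c', hc', hcw⟩ := S.exists_coord hw hb hS
  have h0 : ∀ᶠ z in nb a, b z ∈ T.W ∧ b z ∈ S.W :=
    (hb.eventually (nb_of_isOpen T.isOpen hT)).and (hb.eventually (nb_of_isOpen S.isOpen hS))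
  let φ : A → {b : B // b ∈ T.W ∧ b ∈ S.W} × (Fin r × Fin s → ℂ) := fun z =>
    (near (fun b => b ∈ T.W ∧ b ∈ S.W) ⟨b a, hT, hS⟩ b z, fun ij => c z ij.1 * c' z ij.2)
  have hφ : HolMapAt φ a := holMapAt_prod.2 ⟨hb.near h0, holMapAt_pi.2 fun ij =>
    (holMapAt_pi.1 hc ij.1).mul (holMapAt_pi.1 hc' ij.2)⟩
  refine (HolMapAt.comp ((holMap_tensorChart T S).at (φ a)) hφ).congr (h0.mono fun z hz => ?_)
  have h2 : φ z = (⟨b z, hz⟩, fun ij => c z ij.1 * c' z ij.2) :=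
    Prod.ext (near_val (P := fun b => b ∈ T.W ∧ b ∈ S.W) _ hz) rfl
  rw [h2]
  refine congrArg (Sigma.mk (b z)) ?_
  change ∑ ij : Fin r × Fin s, (c z ij.1 * c' z ij.2) •
    (T.frame ⟨b z, hz.1⟩ ij.1 ⊗ₜ[ℂ] S.frame ⟨b z, hz.2⟩ ij.2) = v z ⊗ₜ[ℂ] w z
  rw [hcv z hz.1, hcw z hz.2, TensorProduct.sum_tmul, Fintype.sum_prod_type]
  refine Finset.sum_congr rfl fun i _ => ?_
  rw [TensorProduct.tmul_sum]
  exact Finset.sum_congr rfl fun j _ => (TensorProduct.smul_tmul_smul _ _ _ _).symm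

end LinearSpace

namespace AffCone
open LinearSpace

variable {N : ℕ} {Y : Set (Projectivization ℂ (Fin (N + 1) → ℂ))}

/-! ### Local sections of the quotient map of the cone -/

theorem holMap_proj : HolMap (proj : Punctured Y → Y) :=
  holMap_to_final (fun _ : Unit => (proj : Punctured Y → Y)) ()

theorem holAt_coord (i : Fin (N + 1)) (x : Punctured Y) :
    HolAt (fun x : Punctured Y => x.1.1 i) x :=
  holMapAt_pi.1 (((holMap_val _).at x.1).comp ((holMap_val _).at x)) i

theorem smul_coord (c : ℂˣ) (x : Punctured Y) (i : Fin (N + 1)) :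
    (c • x).1.1 i = c * x.1.1 i := rfl

theorem exists_coord_ne_zero (x : Punctured Y) : ∃ j, x.1.1 j ≠ 0 := by
  by_contra! h
  exact x.ne_zero (funext h)

theorem proj_surjective : Function.Surjective (proj : Punctured Y → Y) := by
  rintro ⟨y, hy⟩
  induction y using Projectivization.ind with
  | h v hv => exact ⟨⟨⟨v, fun _ => hy⟩, fun h => hv (congrArg Subtype.val h)⟩, rfl⟩

variable (Y) in
/-- A holomorphic section of `U → Y` on the open set `W`, extended arbitrarily to a section on
`Y`. -/
structure LocSec where
  sec : ∀ y : Y, {x : Punctured Y // proj x = y}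
  W : Set Y
  isOpen : IsOpen[top] W
  hol : ∀ y ∈ W, HolMapAt (fun y => (sec y).1) y

/-- On the chart where the `j`-th homogeneous coordinate does not vanish, the normalization of this
coordinate to `1` is a holomorphic section. -/
theorem exists_locSec (y : Y) : ∃ σ : LocSec Y, y ∈ σ.W := by
  classical
  obtain ⟨x₀, rfl⟩ := proj_surjective y
  obtain ⟨j, hj⟩ := exists_coord_ne_zero x₀
  let s : ∀ y : Y, {x : Punctured Y // proj x = y} := fun y =>
    if h : ∃ x : {x : Punctured Y // proj x = y}, x.1.1.1 j = 1 then h.choose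
    else ⟨_, (proj_surjective y).choose_spec⟩
  have hs : ∀ x : Punctured Y, x.1.1 j ≠ 0 → ∀ i, (s (proj x)).1.1.1 i = x.1.1 i * (x.1.1 j)⁻¹ := by
    intro x hx i
    have h : ∃ x' : {x' : Punctured Y // proj x' = proj x}, x'.1.1.1 j = 1 := by
      refine ⟨⟨(Units.mk0 _ hx)⁻¹ • x, ((proj_eq_iff _ _).2 ⟨_, rfl⟩).symm⟩, ?_⟩
      rw [smul_coord, Units.val_inv_eq_inv_val, Units.val_mk0, inv_mul_cancel₀ hx]
    have h1 : (s (proj x)).1.1.1 j = 1 := by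
      simp only [s, dif_pos h]
      exact h.choose_spec
    obtain ⟨c, hc⟩ := (proj_eq_iff x (s (proj x)).1).1 (s (proj x)).2.symm
    rw [hc, smul_coord] at h1
    rw [hc, smul_coord, eq_inv_of_mul_eq_one_left h1, mul_comm]
  let W : Set Y := {y | ∃ x : Punctured Y, proj x = y ∧ x.1.1 j ≠ 0}
  have hW : ∀ x : Punctured Y, proj x ∈ W → x.1.1 j ≠ 0 := by
    rintro x ⟨x', hx', h⟩
    obtain ⟨c, rfl⟩ := (proj_eq_iff _ _).1 hx'
    rw [smul_coord]
    exact mul_ne_zero c.ne_zero h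
  have hWo : IsOpen[top] ((proj : Punctured Y → Y) ⁻¹' W) := isOpen_of_nb fun x hx =>
    ((holAt_coord j x).eventually_ne (hW x hx)).mono fun z hz => ⟨z, rfl, hz⟩
  refine ⟨⟨s, W, (isOpen_final fun _ : Unit => (proj : Punctured Y → Y)).2 fun _ => hWo, ?_⟩,
    x₀, rfl, hj⟩
  refine fun y hy => holMapAt_subtype.2 (holMapAt_subtype.2 (holMapAt_pi.2 fun i => ?_))
  refine holAt_final (fun _ : Unit => (proj : Punctured Y → Y)) W (fun _ => hWo) hy ?_
  intro _ x hx
  have h0 := hW x hx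
  refine hol_congr ?_ ((holAt_coord i x).mul ((holAt_coord j x).inv h0))
  filter_upwards [(holAt_coord j x).eventually_ne h0] with z hz
  exact (hs z hz i).symm

/-! ### Fibers of the line bundles -/

theorem lineFib_apply {e : ℤ} {y : Y} (φ : lineFib Y e y) {c : ℂˣ}
    {x x' : {x : Punctured Y // proj x = y}} (h : x'.1 = c • x.1) :
    φ.1 x' = (c : ℂ) ^ e * φ.1 x := φ.2 c x x' h

theorem exists_smul {y : Y} (x x' : {x : Punctured Y // proj x = y}) : ∃ c : ℂˣ, x'.1 = c • x.1 :=
  (proj_eq_iff _ _).1 (x.2.trans x'.2.symm)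

theorem lineFib_ext {e : ℤ} {y : Y} {φ ψ : lineFib Y e y} (x : {x : Punctured Y // proj x = y})
    (h : φ.1 x = ψ.1 x) : φ = ψ := by
  refine Subtype.ext (funext fun x' => ?_)
  obtain ⟨c, hc⟩ := exists_smul x x'
  rw [lineFib_apply φ hc, lineFib_apply ψ hc, h]

theorem orbit_self (e : ℤ) (x : Punctured Y) (t : ℂ) : (orbit e x t).1 ⟨x, rfl⟩ = t := by
  rw [orbit_apply e x t 1 ⟨x, rfl⟩ (one_smul _ x).symm]
  simp

/-- A point `x` of `U` over `y` identifies the fiber of `H_Y^e` over `y` with `ℂ`: `t` corresponds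
to the orbit of `(x, t)`. -/
def evEquiv (e : ℤ) {y : Y} (x : {x : Punctured Y // proj x = y}) : lineFib Y e y ≃ₗ[ℂ] ℂ :=
  LinearEquiv.ofBijective ((LinearMap.proj x).comp (lineFib Y e y).subtype) (by
    refine ⟨fun φ ψ h => lineFib_ext x h, fun t => ?_⟩
    obtain ⟨x, rfl⟩ := x
    exact ⟨orbit e x t, orbit_self e x t⟩)

theorem evEquiv_symm_apply_self (e : ℤ) {y : Y} (x : {x : Punctured Y // proj x = y}) (t : ℂ) :
    ((evEquiv e x).symm t).1 x = t := (evEquiv e x).apply_symm_apply t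

theorem orbitMap_sec (e : ℤ) {y : Y} (x : {x : Punctured Y // proj x = y}) (t : ℂ) :
    orbitMap e (x.1, t) = ⟨y, (evEquiv e x).symm t⟩ := by
  obtain ⟨x, rfl⟩ := x
  refine Sigma.ext rfl (heq_of_eq (lineFib_ext ⟨x, rfl⟩ ?_))
  exact (orbit_self e x t).trans (evEquiv_symm_apply_self e ⟨x, rfl⟩ t).symm

/-! ### Holomorphic maps to the line bundles -/

theorem holMap_orbitMap (e : ℤ) : HolMap (B := (lineBundle Y e).Tot)
    (orbitMap e : Punctured Y × ℂ → Σ y : Y, lineFib Y e y) :=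
  holMap_to_final (fun _ : Unit => (orbitMap e : Punctured Y × ℂ → Σ y : Y, lineFib Y e y)) ()

theorem holMap_line_base (e : ℤ) : HolMap (fun p : (lineBundle Y e).Tot => p.1) :=
  holMap_from_final (fun _ : Unit => (orbitMap e : Punctured Y × ℂ → Σ y : Y, lineFib Y e y))
    fun _ => holMap_proj.comp holMap_fst

theorem LocSec.holAt_lineCoord (σ : LocSec Y) (e : ℤ) {p : (lineBundle Y e).Tot}
    (hp : p.1 ∈ σ.W) : HolAt (fun p : (lineBundle Y e).Tot => p.2.1 (σ.sec p.1)) p := by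
  refine holAt_final (fun _ : Unit => (orbitMap e : Punctured Y × ℂ → Σ y : Y, lineFib Y e y))
    {p | p.1 ∈ σ.W} (fun _ => ?_) hp ?_
  · exact isOpen_of_nb fun z hz => ((holMap_proj.comp holMap_fst).at z).eventually
      (nb_of_isOpen σ.isOpen hz)
  rintro _ z hz
  obtain ⟨j, hj⟩ := exists_coord_ne_zero z.1
  have hx : HolAt (fun z : Punctured Y × ℂ => z.1.1.1 j) z :=
    (holMap_fst.at z).2 _ (holAt_coord j z.1)
  have hs : HolAt (fun z : Punctured Y × ℂ => (σ.sec (proj z.1)).1.1.1 j) z :=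
    (HolMapAt.comp (ψ := fun y => (σ.sec y).1) (φ := fun z : Punctured Y × ℂ => proj z.1)
      (σ.hol _ hz) ((holMap_proj.comp holMap_fst).at z)).2 _ (holAt_coord j _)
  -- the factor `c` with `σ (proj x) = c x` is a quotient of coordinates
  have key : ∀ w : Punctured Y × ℂ, w.1.1.1 j ≠ 0 → ∃ c : ℂˣ, (σ.sec (proj w.1)).1 = c • w.1 ∧
      (c : ℂ) = (σ.sec (proj w.1)).1.1.1 j * (w.1.1.1 j)⁻¹ := by
    intro w hw
    obtain ⟨c, hc⟩ := exists_smul ⟨w.1, rfl⟩ (σ.sec (proj w.1))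
    refine ⟨c, hc, ?_⟩
    rw [hc, smul_coord, mul_assoc, mul_inv_cancel₀ hw, mul_one]
  have h0 : (σ.sec (proj z.1)).1.1.1 j * (z.1.1.1 j)⁻¹ ≠ 0 := by
    obtain ⟨c, -, hc⟩ := key z hj
    rw [← hc]
    exact c.ne_zero
  refine hol_congr ?_ (((hs.mul (hx.inv hj)).zpow h0 e).mul
    (holMapAt_complex.1 (holMap_snd.at z)))
  filter_upwards [hx.eventually_ne hj] with w hw
  obtain ⟨c, hc, hc'⟩ := key w hw
  rw [← hc']
  exact (orbit_apply e w.1 w.2 c _ hc).symm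

/-- A map to `H_Y^e` is holomorphic iff its base point and its coordinate with respect to a local
section of `U → Y` are. -/
theorem LocSec.holMapAt_line (σ : LocSec Y) {e : ℤ} {A : Type} [HolSpace A]
    {φ : A → (lineBundle Y e).Tot} {a : A} (ha : (φ a).1 ∈ σ.W) :
    HolMapAt φ a ↔ HolMapAt (fun z => (φ z).1) a ∧
      HolAt (fun z => (φ z).2.1 (σ.sec (φ z).1)) a := by
  constructor
  · exact fun h => ⟨((holMap_line_base e).at _).comp h, h.2 _ (σ.holAt_lineCoord e ha)⟩
  · rintro ⟨h1, h2⟩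
    have h3 : HolMapAt (fun z => ((σ.sec (φ z).1).1, (φ z).2.1 (σ.sec (φ z).1))) a :=
      holMapAt_prod.2 ⟨HolMapAt.comp (ψ := fun y => (σ.sec y).1) (σ.hol _ ha) h1,
        holMapAt_complex.2 h2⟩
    refine (((holMap_orbitMap e).at _).comp h3).congr (Filter.Eventually.of_forall fun z => ?_)
    refine (orbitMap_sec e _ _).trans ?_
    exact congrArg (Sigma.mk (φ z).1) ((evEquiv e (σ.sec (φ z).1)).symm_apply_apply (φ z).2)

end AffCone

open HolSpace LinearSpace

namespace LinearSpace

/-! ### Fiber products and kernels -/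

variable {A B : Type} [HolSpace A] [HolSpace B] {n : ℕ}

/-- The maps that define the structure of `E_1 ×_B … ×_B E_n`. -/
abbrev prodTarget (E : Fin n → LinearSpace B) : Option (Fin n) → Target (Σ b, ∀ i, (E i).fib b) :=
  fun j => j.elim ⟨fun p => p.1⟩ (fun i => Target.mk (Z := (E i).Tot) fun p => ⟨p.1, p.2 i⟩)

/-- The map that defines the structure of a kernel. -/
abbrev kerTarget {E F : LinearSpace B} (φ : ∀ b, E.fib b →ₗ[ℂ] F.fib b) :
    Unit → Target (Σ b, LinearMap.ker (φ b)) :=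
  fun _ => Target.mk (Z := E.Tot) fun p => ⟨p.1, p.2.1⟩

theorem holMap_prod_base (E : Fin n → LinearSpace B) : HolMap fun p : (prod E).Tot => p.1 :=
  holMap_of_initial (prodTarget E) none

theorem holMapAt_prod_iff {E : Fin n → LinearSpace B} {φ : A → (prod E).Tot} {a : A} :
    HolMapAt φ a ↔ HolMapAt (fun z => (φ z).1) a ∧
      ∀ i, HolMapAt (B := (E i).Tot) (fun z => ⟨(φ z).1, (φ z).2 i⟩) a :=
  (holMapAt_initial (prodTarget E)).trans Option.forall

theorem isHom_ker {C : Type} {E F : LinearSpace C}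
    (φ : ∀ b, E.fib b →ₗ[ℂ] F.fib b) : IsHom (E := ker φ) (F := E) (kerIncl φ) :=
  holMap_of_initial (kerTarget φ) ()

theorem holMapAt_ker_iff {C : Type} {E F : LinearSpace C}
    {φ : ∀ b, E.fib b →ₗ[ℂ] F.fib b}
    {ψ : A → (ker φ).Tot} {a : A} :
    HolMapAt ψ a ↔ HolMapAt (B := E.Tot) (fun z => ⟨(ψ z).1, (ψ z).2.1⟩) a :=
  (holMapAt_initial (kerTarget φ)).trans ⟨fun h => h (), fun h _ => h⟩

end LinearSpace

namespace AffCone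

variable {N : ℕ} {Y : Set (Projectivization ℂ (Fin (N + 1) → ℂ))}

/-! ### The bundles and homomorphisms of the exact sequence -/

theorem LocSec.holAt_comp (σ : LocSec Y) {g : Cone Y → ℂ} (hg : ∀ x, HolAt g x) {y : Y}
    (hy : y ∈ σ.W) : HolAt (fun y => g (σ.sec y).1.1) y :=
  (((holMap_val _).at _).comp (σ.hol y hy)).2 g (hg _)

theorem lineBundle_isVectorBundle (e : ℤ) : (lineBundle Y e).IsVectorBundle 1 := by
  intro y
  obtain ⟨σ, hσ⟩ := exists_locSec y
  refine ⟨LocTriv.ofCoord (lineBundle Y e) σ.isOpen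
    (fun y => (evEquiv e (σ.sec y)).trans (LinearEquiv.funUnique (Fin 1) ℂ ℂ).symm)
    (holMap_line_base e) (fun p _ => p.2.1 (σ.sec p.1))
    (fun p hp => holMapAt_pi.2 fun _ => σ.holAt_lineCoord e hp) (fun b v => rfl) ?_, hσ⟩
  refine holMap_iff.2 fun w => (σ.holMapAt_line w.1.2).2
    ⟨((holMap_val _).comp holMap_fst).at w, ?_⟩
  refine hol_congr (Filter.Eventually.of_forall fun z => ?_) (holMapAt_pi.1 (holMap_snd.at w) 0)
  exact (evEquiv_symm_apply_self e (σ.sec z.1.1) (z.2 0)).symm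

variable {n : ℕ}

/-- A map to `H_Y^{e_1} ×_Y … ×_Y H_Y^{e_n}` is holomorphic iff its base point and its coordinates
with respect to a local section of `U → Y` are. -/
theorem LocSec.holMapAt_sum (σ : LocSec Y) {e : Fin n → ℤ} {A : Type} [HolSpace A]
    {φ : A → (sumBundle Y e).Tot} {a : A} (ha : (φ a).1 ∈ σ.W) :
    HolMapAt φ a ↔ HolMapAt (fun z => (φ z).1) a ∧
      ∀ i, HolAt (fun z => ((φ z).2 i).1 (σ.sec (φ z).1)) a := by
  refine holMapAt_prod_iff.trans ?_
  refine and_congr_right fun h => forall_congr' fun i => ?_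
  refine (σ.holMapAt_line (e := e i) (φ := fun z => ⟨(φ z).1, (φ z).2 i⟩) ha).trans ?_
  exact and_iff_right h

theorem sumBundle_isVectorBundle (e : Fin n → ℤ) : (sumBundle Y e).IsVectorBundle n := by
  intro y
  obtain ⟨σ, hσ⟩ := exists_locSec y
  refine ⟨LocTriv.ofCoord (sumBundle Y e) σ.isOpen
    (fun y => LinearEquiv.piCongrRight fun i => evEquiv (e i) (σ.sec y))
    (holMap_prod_base fun i => lineBundle Y (e i)) (fun p i => (p.2 i).1 (σ.sec p.1))
    (fun p hp => holMapAt_pi.2 ((σ.holMapAt_sum hp).1 (holMapAt_id p)).2) (fun b v => rfl) ?_, hσ⟩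
  refine holMap_iff.2 fun w => (σ.holMapAt_sum w.1.2).2
    ⟨((holMap_val _).comp holMap_fst).at w, fun i => ?_⟩
  refine hol_congr (Filter.Eventually.of_forall fun z => ?_) (holMapAt_pi.1 (holMap_snd.at w) i)
  exact (evEquiv_symm_apply_self (e i) (σ.sec z.1.1) (z.2 i)).symm

variable {f : Fin n → Cone Y → ℂ} {d e : Fin n → ℤ} {m : ℤ}
  (hf : ∀ i, IsHomogeneous (f i) (d i)) (h : ∀ i, d i + e i = m)

theorem sumHom_apply {y : Y} (v : (sumBundle Y e).fib y) (x : {x : Punctured Y // proj x = y}) :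
    (sumHom f hf h y v).1 x = ∑ i, f i x.1.1 * (v i).1 x := by
  simp only [sumHom, LinearMap.sum_apply]
  refine (congrFun (map_sum (lineFib Y m y).subtype
    (fun i => mulHom (f i) (hf i) (h i) y (v i)) Finset.univ) x).trans ?_
  rw [Finset.sum_apply]
  rfl

theorem syz_relation {y : Y} (v : (syzBundle f hf h).fib y)
    (x : {x : Punctured Y // proj x = y}) : ∑ i, f i x.1.1 * (v.1 i).1 x = 0 := by
  rw [← sumHom_apply hf h, LinearMap.mem_ker.1 v.2]
  rfl

/-- The vector in the fiber of `V_m` over `y` whose coordinates at the point `x` over `y` are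
`t_1, …, t_n`. -/
def syzMk {y : Y} (x : {x : Punctured Y // proj x = y}) (t : Fin n → ℂ)
    (ht : ∑ i, f i x.1.1 * t i = 0) : (syzBundle f hf h).fib y :=
  ⟨fun i => (evEquiv (e i) x).symm (t i), by
    refine lineFib_ext x ((sumHom_apply hf h _ x).trans ?_)
    simp only [evEquiv_symm_apply_self, ht]
    rfl⟩

theorem syzMk_apply {y : Y} (x : {x : Punctured Y // proj x = y}) (t : Fin n → ℂ)
    (ht : ∑ i, f i x.1.1 * t i = 0) (i : Fin n) : ((syzMk hf h x t ht).1 i).1 x = t i :=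
  evEquiv_symm_apply_self _ _ _

theorem syz_ext {y : Y} {v w : (syzBundle f hf h).fib y} (x : {x : Punctured Y // proj x = y})
    (hvw : ∀ i, (v.1 i).1 x = (w.1 i).1 x) : v = w :=
  Subtype.ext (funext fun i => lineFib_ext x (hvw i))

/-- A map to `V_m` is holomorphic iff its base point and its coordinates with respect to a local
section of `U → Y` are. -/
theorem LocSec.holMapAt_syz (σ : LocSec Y) {A : Type} [HolSpace A]
    {φ : A → (syzBundle f hf h).Tot} {a : A} (ha : (φ a).1 ∈ σ.W) :
    HolMapAt φ a ↔ HolMapAt (fun z => (φ z).1) a ∧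
      ∀ i, HolAt (fun z => ((φ z).2.1 i).1 (σ.sec (φ z).1)) a := by
  exact holMapAt_ker_iff.trans
    (σ.holMapAt_sum (e := e) (φ := fun z => ⟨(φ z).1, (φ z).2.1⟩) ha)

theorem holMap_syz_base : HolMap (fun p : (syzBundle f hf h).Tot => p.1) :=
  (holMap_prod_base fun i => lineBundle Y (e i)).comp (isHom_ker (sumHom f hf h))

theorem isHom_sumHom (hol : ∀ i x, HolAt (f i) x) :
    IsHom (E := sumBundle Y e) (F := lineBundle Y m) (sumHom f hf h) := by
  refine holMap_iff.2 fun p => ?_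
  obtain ⟨σ, hσ⟩ := exists_locSec p.1
  refine (σ.holMapAt_line (φ := totMap (E := sumBundle Y e) (F := lineBundle Y m) (sumHom f hf h))
    hσ).2 ⟨(holMap_prod_base fun i => lineBundle Y (e i)).at p, ?_⟩
  refine hol_congr (Filter.Eventually.of_forall fun q => (sumHom_apply hf h q.2 _).symm) ?_
  have hb : HolMap fun p : (sumBundle Y e).Tot => p.1 := holMap_prod_base _
  exact HolAt.sum fun i => ((hb.at p).2 _ (σ.holAt_comp (hol i) hσ)).mul
    (((σ.holMapAt_sum hσ).1 (holMapAt_id p)).2 i)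

theorem exists_ne_zero (zero : ∀ x : Cone Y, (∀ i, f i x = 0) ↔ x = vertex Y) (x : Punctured Y) :
    ∃ i, f i x.1 ≠ 0 := by
  by_contra! h0
  exact x.2 ((zero x.1).1 h0)

theorem sumHom_surjective (zero : ∀ x : Cone Y, (∀ i, f i x = 0) ↔ x = vertex Y) (y : Y) :
    Function.Surjective (sumHom f hf h y) := by
  intro φ
  obtain ⟨x, rfl⟩ := proj_surjective y
  obtain ⟨i, hi⟩ := exists_ne_zero zero x
  refine ⟨fun k => (evEquiv (e k) ⟨x, rfl⟩).symm (if k = i then φ.1 ⟨x, rfl⟩ / f i x.1 else 0), ?_⟩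
  refine lineFib_ext ⟨x, rfl⟩ ((sumHom_apply hf h _ _).trans ?_)
  simp only [evEquiv_symm_apply_self, mul_ite, mul_zero, Finset.sum_ite_eq', Finset.mem_univ,
    if_true]
  exact mul_div_cancel₀ _ hi

/-! ### The rank of the syzygy bundle -/

theorem sum_insertNth {r : ℕ} {F : Fin (r + 1) → ℂ} (i : Fin (r + 1)) (hi : F i ≠ 0)
    (w : Fin r → ℂ) : ∑ k, F k * (i.insertNth (α := fun _ => ℂ)
      (-(∑ a, F (i.succAbove a) * w a) * (F i)⁻¹) w) k = 0 := by
  rw [Fin.sum_univ_succAbove _ i]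
  simp only [Fin.insertNth_apply_same, Fin.insertNth_apply_succAbove]
  field_simp
  ring

variable {r : ℕ} {f : Fin (r + 1) → Cone Y → ℂ} {d e : Fin (r + 1) → ℤ}
  (hf : ∀ i, IsHomogeneous (f i) (d i)) (h : ∀ i, d i + e i = m)

/-- Where `f_i` does not vanish, the equation `∑ f_k t_k = 0` can be solved for `t_i`, and the
other coordinates identify the fiber of `V_m` with `ℂ^(n-1)`. -/
def syzTriv (i : Fin (r + 1)) {y : Y} (x : {x : Punctured Y // proj x = y})
    (hi : f i x.1.1 ≠ 0) : (syzBundle f hf h).fib y ≃ₗ[ℂ] (Fin r → ℂ) where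
  toFun v a := (v.1 (i.succAbove a)).1 x
  map_add' _ _ := rfl
  map_smul' _ _ := rfl
  invFun w := syzMk hf h x _ (sum_insertNth (F := fun k => f k x.1.1) i hi w)
  left_inv v := by
    refine syz_ext hf h x fun k => ?_
    rw [syzMk_apply]
    revert k
    rw [Fin.forall_iff_succAbove i]
    refine ⟨?_, fun a => by rw [Fin.insertNth_apply_succAbove]⟩
    have h1 := syz_relation hf h v x
    rw [Fin.sum_univ_succAbove _ i] at h1
    rw [Fin.insertNth_apply_same, ← eq_neg_of_add_eq_zero_left h1, mul_comm,
      inv_mul_cancel_left₀ hi]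
  right_inv w := by
    funext a
    exact (syzMk_apply hf h x _ _ _).trans (Fin.insertNth_apply_succAbove _ _ _ _)

theorem syzBundle_isVectorBundle (hol : ∀ i x, HolAt (f i) x)
    (zero : ∀ x : Cone Y, (∀ i, f i x = 0) ↔ x = vertex Y) :
    (syzBundle f hf h).IsVectorBundle r := by
  intro y
  obtain ⟨σ, hσ⟩ := exists_locSec y
  obtain ⟨i, hi⟩ := exists_ne_zero zero (σ.sec y).1
  let W : Set Y := {y | y ∈ σ.W ∧ f i (σ.sec y).1.1 ≠ 0}
  have hW : IsOpen[top] W := isOpen_of_nb fun z hz =>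
    (nb_of_isOpen σ.isOpen hz.1).and ((σ.holAt_comp (hol i) hz.1).eventually_ne hz.2)
  refine ⟨LocTriv.ofCoord (syzBundle f hf h) hW (fun y => syzTriv hf h i (σ.sec y) y.2.2)
    (holMap_syz_base hf h) (fun p a => (p.2.1 (i.succAbove a)).1 (σ.sec p.1))
    (fun p hp => holMapAt_pi.2 fun a =>
      ((σ.holMapAt_syz hf h hp.1).1 (holMapAt_id p)).2 (i.succAbove a)) (fun b v => rfl) ?_,
    hσ, hi⟩
  have hb : HolMap (fun w : W × (Fin r → ℂ) => w.1.1) := (holMap_val _).comp holMap_fst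
  refine holMap_iff.2 fun w => (σ.holMapAt_syz hf h w.1.2.1).2 ⟨hb.at w, fun k => ?_⟩
  have hfk : ∀ k, HolAt (fun w : W × (Fin r → ℂ) => f k (σ.sec w.1.1).1.1) w := fun k =>
    (hb.at w).2 _ (σ.holAt_comp (hol k) w.1.2.1)
  have hw := holMapAt_pi.1 (holMap_snd.at w)
  refine hol_congr (Filter.Eventually.of_forall fun z => (syzMk_apply hf h _ _
    (sum_insertNth (F := fun k => f k (σ.sec z.1.1).1.1) i z.1.2.2 z.2) k).symm) ?_
  revert k
  rw [Fin.forall_iff_succAbove i]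
  simp only [Fin.insertNth_apply_same, Fin.insertNth_apply_succAbove]
  refine ⟨?_, hw⟩
  have h1 : HolAt (fun z : W × (Fin r → ℂ) =>
      ∑ a, f (i.succAbove a) (σ.sec z.1.1).1.1 * z.2 a) w :=
    HolAt.sum fun a => (hfk (i.succAbove a)).mul (hw a)
  exact (h1.comp_one (G := fun u => -u) analyticAt_id.neg).mul ((hfk i).inv w.1.2.2)

end AffCone

namespace AffCone

variable {N : ℕ} {Y : Set (Projectivization ℂ (Fin (N + 1) → ℂ))} {n : ℕ}
  {f : Fin n → Cone Y → ℂ} {d e e' : Fin n → ℤ} {m m' : ℤ}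
  (hf : ∀ i, IsHomogeneous (f i) (d i)) (h : ∀ i, d i + e i = m) (h' : ∀ i, d i + e' i = m')

/-! ### The syzygy bundle as a quotient -/

theorem syzTot_ext {p q : (syzBundle f hf h).Tot} (x : Punctured Y) (hp : proj x = p.1)
    (hq : proj x = q.1) (hpq : ∀ i, (p.2.1 i).1 ⟨x, hp⟩ = (q.2.1 i).1 ⟨x, hq⟩) : p = q := by
  obtain ⟨y, v⟩ := p
  obtain ⟨y', w⟩ := q
  obtain rfl : y = y' := hp.symm.trans hq
  exact congrArg (Sigma.mk y) (syz_ext hf h ⟨x, hp⟩ hpq)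

theorem holMap_relQuot : HolMap (relQuot f hf h) := by
  refine holMap_iff.2 fun p => ?_
  obtain ⟨σ, hσ⟩ := exists_locSec (proj p.1.1)
  refine (σ.holMapAt_syz hf h hσ).2
    ⟨(holMap_proj.comp (holMap_fst.comp (holMap_val _))).at p, fun i => ?_⟩
  have h1 : HolMapAt (fun p : relSpace f => (p.1.1, p.1.2 i)) p :=
    holMapAt_prod.2 ⟨(holMap_fst.comp (holMap_val _)).at p, holMapAt_complex.2
      (holMapAt_pi.1 ((holMap_snd.comp (holMap_val _)).at p) i)⟩
  exact (((holMap_orbitMap (e i)).at _).comp h1).2 _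
    (σ.holAt_lineCoord (e i) (p := orbitMap (e i) (p.1.1, p.1.2 i)) hσ)

theorem relQuot_eq_iff (p p' : relSpace f) : relQuot f hf h p = relQuot f hf h p' ↔
    ∃ c : ℂˣ, p' = (relAction f hf h).smul c p := by
  constructor
  · intro hp
    obtain ⟨c, hc⟩ := (proj_eq_iff p.1.1 p'.1.1).1 (congrArg Sigma.fst hp)
    refine ⟨c, Subtype.ext (Prod.ext hc (funext fun i => ?_))⟩
    have h1 : orbitMap (e i) (p.1.1, p.1.2 i) = orbitMap (e i) (p'.1.1, p'.1.2 i) :=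
      congrArg (fun q : (syzBundle f hf h).Tot => (⟨q.1, q.2.1 i⟩ : Σ y, lineFib Y (e i) y)) hp
    obtain ⟨c', hc'⟩ := (orbitMap_eq_iff _ _ _).1 h1
    obtain rfl := smul_inj p.1.1 (hc.symm.trans (congrArg Prod.fst hc'))
    exact congrArg Prod.snd hc'
  · rintro ⟨c, rfl⟩
    refine syzTot_ext hf h (c • p.1.1) ((proj_eq_iff _ _).2 ⟨c, rfl⟩).symm rfl fun i => ?_
    exact (orbit_apply (e i) p.1.1 (p.1.2 i) c _ rfl).trans (orbit_self _ _ _).symm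

theorem isQuotient_relQuot :
    @IsQuotient ℂˣ _ _ _ (relAction f hf h) _ _ (relQuot f hf h) := by
  let _ := relAction f hf h
  refine isQuotient_of_sections (holMap_relQuot hf h) (relQuot_eq_iff hf h) fun p => ?_
  obtain ⟨σ, hσ⟩ := exists_locSec p.1
  have hp := (σ.holMapAt_syz hf h hσ).1 (holMapAt_id p)
  refine ⟨fun p => ⟨((σ.sec p.1).1, fun i => (p.2.1 i).1 (σ.sec p.1)),
    syz_relation hf h p.2 _⟩, fun q => ?_, ?_⟩
  · exact syzTot_ext hf h (σ.sec q.1).1 rfl (σ.sec q.1).2 fun i => orbit_self _ _ _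
  · exact holMapAt_subtype.2 (holMapAt_prod.2
      ⟨HolMapAt.comp (ψ := fun y => (σ.sec y).1) (σ.hol _ hσ) hp.1, holMapAt_pi.2 hp.2⟩)

/-! ### Change of the twist -/

variable (Y) in
/-- An arbitrary point of `U` over `y`. -/
def basePt (y : Y) : {x : Punctured Y // proj x = y} := ⟨_, (proj_surjective y).choose_spec⟩

/-- The isomorphism of the fibers of `V_m` and `V_{m'}` over `y` which preserves the coordinates at
the point `x` over `y`. -/
def syzCast {y : Y} (x : {x : Punctured Y // proj x = y}) :
    (syzBundle f hf h).fib y ≃ₗ[ℂ] (syzBundle f hf h').fib y where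
  toFun v := syzMk hf h' x (fun i => (v.1 i).1 x) (syz_relation hf h v x)
  map_add' v w := syz_ext hf h' x fun i => by
    rw [syzMk_apply]
    change _ = ((syzMk hf h' x _ (syz_relation hf h v x)).1 i).1 x
      + ((syzMk hf h' x _ (syz_relation hf h w x)).1 i).1 x
    rw [syzMk_apply, syzMk_apply]
    rfl
  map_smul' a v := syz_ext hf h' x fun i => by
    rw [syzMk_apply]
    change _ = a * ((syzMk hf h' x _ (syz_relation hf h v x)).1 i).1 x
    rw [syzMk_apply]
    rfl
  invFun v := syzMk hf h x (fun i => (v.1 i).1 x) (syz_relation hf h' v x)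
  left_inv v := syz_ext hf h x fun i => by rw [syzMk_apply, syzMk_apply]
  right_inv v := syz_ext hf h' x fun i => by rw [syzMk_apply, syzMk_apply]

theorem syzCast_self {y : Y} (x : {x : Punctured Y // proj x = y}) (v : (syzBundle f hf h).fib y)
    (i : Fin n) : ((syzCast hf h h' x v).1 i).1 x = (v.1 i).1 x :=
  syzMk_apply hf h' x _ (syz_relation hf h v x) i

/-- The coordinates of the same vector of `ℂ^n` with respect to the two twists differ by a scalar
factor that is the same for all `i`. -/
theorem syzCast_smul {y : Y} {x x' : {x : Punctured Y // proj x = y}} {c : ℂˣ}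
    (hc : x'.1 = c • x.1) (v : (syzBundle f hf h).fib y) (i : Fin n) :
    ((syzCast hf h h' x v).1 i).1 x' = (c : ℂ) ^ (m' - m) * (v.1 i).1 x' := by
  have h1 : e' i = (m' - m) + e i := by linarith [h i, h' i]
  rw [lineFib_apply _ hc, syzCast_self, lineFib_apply (v.1 i) hc, h1, zpow_add₀ c.ne_zero,
    mul_assoc]

/-- The isomorphism `V_m ⊗ H_Y^{m'-m} ≅ V_{m'}` on fibers. -/
def twistEquiv (y : Y) :
    (syzBundle f hf h).fib y ⊗[ℂ] (lineBundle Y (m' - m)).fib y ≃ₗ[ℂ] (syzBundle f hf h').fib y :=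
  ((TensorProduct.congr (LinearEquiv.refl ℂ ((syzBundle f hf h).fib y))
    (evEquiv (m' - m) (basePt Y y))).trans (TensorProduct.rid ℂ _)).trans
      (syzCast hf h h' (basePt Y y))

theorem twistEquiv_tmul {y : Y} (v : (syzBundle f hf h).fib y)
    (s : (lineBundle Y (m' - m)).fib y) (i : Fin n) (x : {x : Punctured Y // proj x = y}) :
    ((twistEquiv hf h h' y (v ⊗ₜ[ℂ] s)).1 i).1 x = (v.1 i).1 x * s.1 x := by
  have h1 : twistEquiv hf h h' y (v ⊗ₜ[ℂ] s)
      = s.1 (basePt Y y) • syzCast hf h h' (basePt Y y) v :=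
    map_smul (syzCast hf h h' (basePt Y y)) (s.1 (basePt Y y)) v
  obtain ⟨c, hc⟩ := exists_smul (basePt Y y) x
  rw [h1]
  change s.1 (basePt Y y) * ((syzCast hf h h' (basePt Y y) v).1 i).1 x = _
  rw [syzCast_smul hf h h' hc, lineFib_apply s hc]
  ring

theorem linear_sum_tmul {M M' κ κ' : Type*} [AddCommGroup M] [Module ℂ M] [AddCommGroup M']
    [Module ℂ M'] [Fintype κ] [Fintype κ'] (L : M ⊗[ℂ] M' →ₗ[ℂ] ℂ) (w : κ × κ' → ℂ) (u : κ → M)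
    (v : κ' → M') : L (∑ ij : κ × κ', w ij • (u ij.1 ⊗ₜ[ℂ] v ij.2))
      = ∑ ij : κ × κ', w ij * L (u ij.1 ⊗ₜ[ℂ] v ij.2) := by
  simp only [map_sum, map_smul, smul_eq_mul]

theorem twistEquiv_sum {y : Y} {r s : ℕ} (w : Fin r × Fin s → ℂ)
    (u : Fin r → (syzBundle f hf h).fib y) (v : Fin s → (lineBundle Y (m' - m)).fib y) (i : Fin n)
    (x : {x : Punctured Y // proj x = y}) :
    ((twistEquiv hf h h' y (∑ ij : Fin r × Fin s, w ij • (u ij.1 ⊗ₜ[ℂ] v ij.2))).1 i).1 x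
      = ∑ ij : Fin r × Fin s, w ij * (((u ij.1).1 i).1 x * (v ij.2).1 x) := by
  let L : (syzBundle f hf h).fib y ⊗[ℂ] (lineBundle Y (m' - m)).fib y →ₗ[ℂ] ℂ :=
    ((evEquiv (e' i) x).toLinearMap.comp ((LinearMap.proj i).comp
      (LinearMap.ker (sumHom f hf h' y)).subtype)).comp (twistEquiv hf h h' y).toLinearMap
  exact (linear_sum_tmul L w u v).trans (Finset.sum_congr rfl fun ij _ =>
    congrArg (w ij * ·) (twistEquiv_tmul hf h h' _ _ i x))

theorem isIso_twistEquiv {r : ℕ} (hV : (syzBundle f hf h).IsVectorBundle r) :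
    IsIso (E := (syzBundle f hf h).tensor (lineBundle Y (m' - m))) (F := syzBundle f hf h')
      (twistEquiv hf h h') := by
  constructor
  · refine holMap_from_tensor fun r s T S => holMap_iff.2 fun w => ?_
    obtain ⟨σ, hσ⟩ := exists_locSec w.1.1
    refine (σ.holMapAt_syz hf h' hσ).2 ⟨((holMap_val _).comp holMap_fst).at w, fun i => ?_⟩
    have hT : ∀ k, HolAt (fun w : {b : Y // b ∈ T.W ∧ b ∈ S.W} × (Fin r × Fin s → ℂ) =>
        ((T.frame ⟨w.1.1, w.1.2.1⟩ k).1 i).1 (σ.sec w.1.1)) w := by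
      intro k
      have h1 : HolMapAt (fun w : {b : Y // b ∈ T.W ∧ b ∈ S.W} × (Fin r × Fin s → ℂ) =>
          (⟨w.1.1, w.1.2.1⟩ : T.W)) w :=
        holMapAt_subtype.2 (((holMap_val _).comp holMap_fst).at w)
      exact ((σ.holMapAt_syz hf h hσ).1
        (HolMapAt.comp (Z := (syzBundle f hf h).Tot) ((T.holMap_frame k).at _) h1)).2 i
    have hS : ∀ k, HolAt (fun w : {b : Y // b ∈ T.W ∧ b ∈ S.W} × (Fin r × Fin s → ℂ) =>
        (S.frame ⟨w.1.1, w.1.2.2⟩ k).1 (σ.sec w.1.1)) w := by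
      intro k
      have h1 : HolMapAt (fun w : {b : Y // b ∈ T.W ∧ b ∈ S.W} × (Fin r × Fin s → ℂ) =>
          (⟨w.1.1, w.1.2.2⟩ : S.W)) w :=
        holMapAt_subtype.2 (((holMap_val _).comp holMap_fst).at w)
      exact ((σ.holMapAt_line hσ).1
        (HolMapAt.comp (Z := (lineBundle Y (m' - m)).Tot) ((S.holMap_frame k).at _) h1)).2
    refine hol_congr (Filter.Eventually.of_forall fun z =>
      (twistEquiv_sum hf h h' z.2 _ _ i _).symm) ?_
    exact HolAt.sum fun ij => (holMapAt_pi.1 (holMap_snd.at w) ij).mul ((hT ij.1).mul (hS ij.2))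
  · refine holMap_iff.2 fun p => ?_
    obtain ⟨σ, hσ⟩ := exists_locSec p.1
    have hp := (σ.holMapAt_syz hf h' hσ).1 (holMapAt_id p)
    -- the inverse is `[x, t] ↦ [x, t] ⊗ [x, 1]` with `x` the value of the section `σ`
    have h1 : HolMapAt (B := (syzBundle f hf h).Tot) (fun q : (syzBundle f hf h').Tot =>
        ⟨q.1, syzCast hf h' h (σ.sec q.1) q.2⟩) p := by
      refine (σ.holMapAt_syz hf h hσ).2 ⟨hp.1, fun i => ?_⟩
      exact hol_congr (Filter.Eventually.of_forall fun q => (syzCast_self hf h' h _ q.2 i).symm)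
        (hp.2 i)
    have h2 : HolMapAt (B := (lineBundle Y (m' - m)).Tot) (fun q : (syzBundle f hf h').Tot =>
        ⟨q.1, (evEquiv (m' - m) (σ.sec q.1)).symm 1⟩) p := by
      refine (σ.holMapAt_line hσ).2 ⟨hp.1, ?_⟩
      exact hol_congr (Filter.Eventually.of_forall fun q => (evEquiv_symm_apply_self _ _ 1).symm)
        (holAt_const 1 p)
    refine (holMapAt_tmul hV (lineBundle_isVectorBundle (m' - m)) h1 h2 hp.1).congr
      (Filter.Eventually.of_forall fun q => congrArg (Sigma.mk q.1) ?_)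
    refine (LinearEquiv.eq_symm_apply _).2 (syz_ext hf h' (σ.sec q.1) fun i => ?_)
    refine (twistEquiv_tmul hf h h' _ _ i (σ.sec q.1)).trans ?_
    rw [evEquiv_symm_apply_self, mul_one]
    exact syzCast_self hf h' h (σ.sec q.1) q.2 i

/-! ### The projective bundle -/

theorem mk_syzCast {y : Y} (x x' : {x : Punctured Y // proj x = y})
    {v : (syzBundle f hf h).fib y} (hv : syzCast hf h h' x v ≠ 0)
    (hv' : syzCast hf h h' x' v ≠ 0) :
    Projectivization.mk ℂ (syzCast hf h h' x v) hv
      = Projectivization.mk ℂ (syzCast hf h h' x' v) hv' := by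
  obtain ⟨c, hc⟩ := exists_smul x x'
  refine (Projectivization.mk_eq_mk_iff ℂ _ _ hv hv').2 ⟨c ^ (m' - m), ?_⟩
  refine syz_ext hf h' x' fun i => ?_
  rw [syzCast_smul hf h h' hc, ← syzCast_self hf h h' x' v i, ← Units.val_zpow_eq_zpow_val]
  rfl

/-- The bijection of the fibers of `ℙ(V_m)` and `ℙ(V_{m'})`. -/
def projEquiv (y : Y) : Projectivization ℂ ((syzBundle f hf h).fib y) ≃
    Projectivization ℂ ((syzBundle f hf h').fib y) where
  toFun := Projectivization.map (syzCast hf h h' (basePt Y y)).toLinearMap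
    (syzCast hf h h' (basePt Y y)).injective
  invFun := Projectivization.map (syzCast hf h' h (basePt Y y)).toLinearMap
    (syzCast hf h' h (basePt Y y)).injective
  left_inv := Projectivization.ind fun v hv => by
    simp only [Projectivization.map_mk]
    congr 1
    exact (syzCast hf h h' (basePt Y y)).symm_apply_apply v
  right_inv := Projectivization.ind fun v hv => by
    simp only [Projectivization.map_mk]
    congr 1
    exact (syzCast hf h h' (basePt Y y)).apply_symm_apply v

theorem projEquiv_mk {y : Y} (x : {x : Punctured Y // proj x = y})
    {v : (syzBundle f hf h).fib y} (hv : v ≠ 0) (hv' : syzCast hf h h' x v ≠ 0) :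
    projEquiv hf h h' y (Projectivization.mk ℂ v hv)
      = Projectivization.mk ℂ (syzCast hf h h' x v) hv' :=
  (Projectivization.map_mk (syzCast hf h h' (basePt Y y)).toLinearMap
    (syzCast hf h h' (basePt Y y)).injective v hv).trans (mk_syzCast hf h h' (basePt Y y) x
      ((LinearEquiv.map_ne_zero_iff _).2 hv) hv')

theorem holMap_projEquiv : HolMap (A := (syzBundle f hf h).PTot) (B := (syzBundle f hf h').PTot)
    fun p => ⟨p.1, projEquiv hf h h' p.1 p.2⟩ := by
  refine holMap_from_final (fun _ : Unit => (syzBundle f hf h).toPTot) fun _ =>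
    holMap_iff.2 fun p => ?_
  obtain ⟨σ, hσ⟩ := exists_locSec p.1.1
  have hp := (σ.holMapAt_syz hf h hσ).1 ((holMap_val _).at p)
  let φ : {p : (syzBundle f hf h).Tot // p.2 ≠ 0} → {p : (syzBundle f hf h').Tot // p.2 ≠ 0} :=
    fun q => ⟨⟨q.1.1, syzCast hf h h' (σ.sec q.1.1) q.1.2⟩,
      (LinearEquiv.map_ne_zero_iff _).2 q.2⟩
  have h1 : HolMapAt φ p := by
    refine holMapAt_subtype.2 ((σ.holMapAt_syz hf h' hσ).2 ⟨hp.1, fun i => ?_⟩)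
    exact hol_congr (Filter.Eventually.of_forall fun q => (syzCast_self hf h h' _ q.1.2 i).symm)
      (hp.2 i)
  have h2 : HolMap (B := (syzBundle f hf h').PTot) (syzBundle f hf h').toPTot :=
    holMap_to_final (fun _ : Unit => (syzBundle f hf h').toPTot) ()
  refine (HolMapAt.comp (Z := (syzBundle f hf h').PTot) (h2.at (φ p)) h1).congr
    (Filter.Eventually.of_forall fun q => ?_)
  exact congrArg (Sigma.mk q.1.1) (projEquiv_mk hf h h' (σ.sec q.1.1) q.2 (φ q).2).symm

theorem syzCast_relQuot (p : relSpace f) : syzCast hf h h' ⟨p.1.1, rfl⟩ (relQuot f hf h p).2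
    = (relQuot f hf h' p).2 := by
  refine syz_ext hf h' ⟨p.1.1, rfl⟩ fun i => ?_
  refine (syzCast_self hf h h' ⟨p.1.1, rfl⟩ (relQuot f hf h p).2 i).trans ?_
  exact (orbit_self (e i) p.1.1 (p.1.2 i)).trans (orbit_self (e' i) p.1.1 (p.1.2 i)).symm

end AffCone

namespace AffCone

variable {N : ℕ} {Y : Set (Projectivization ℂ (Fin (N + 1) → ℂ))}

/-! ### The determinant of the syzygy bundle -/

/-- The determinant with rows `t, v_1, …, v_r`, where the `v_a` are in the hyperplane `F = 0`,
depends only on `F(t)`. -/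
theorem det_vecCons_congr {r : ℕ} {F : Fin (r + 1) → ℂ} (hF : F ≠ 0) {t t' : Fin (r + 1) → ℂ}
    (ht : ∑ i, F i * t i = ∑ i, F i * t' i) {v : Fin r → Fin (r + 1) → ℂ}
    (hv : ∀ a, ∑ i, F i * v a i = 0) :
    Matrix.det (Matrix.vecCons t v : Matrix (Fin (r + 1)) (Fin (r + 1)) ℂ)
      = Matrix.det (Matrix.vecCons t' v : Matrix (Fin (r + 1)) (Fin (r + 1)) ℂ) := by
  let D := (Matrix.detRowAlternating (n := Fin (r + 1)) (R := ℂ)).curryLeft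
  change D t v = D t' v
  rw [← sub_eq_zero, ← AlternatingMap.sub_apply, ← map_sub]
  change Matrix.det (Matrix.vecCons (t - t') v : Matrix (Fin (r + 1)) (Fin (r + 1)) ℂ) = 0
  refine Matrix.exists_mulVec_eq_zero_iff.1 ⟨F, hF, funext fun a => ?_⟩
  simp only [Matrix.mulVec, dotProduct, Pi.zero_apply]
  simp only [mul_comm _ (F _)]
  cases a using Fin.cases with
  | zero =>
    simp only [Matrix.cons_val_zero, Pi.sub_apply, mul_sub, Finset.sum_sub_distrib, ht, sub_self]
  | succ a => exact hv a

/-- A basis of the hyperplane `F = 0` together with a vector outside of it is a basis. -/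
theorem det_vecCons_ne_zero {r : ℕ} {F t : Fin (r + 1) → ℂ} (ht : ∑ i, F i * t i = 1)
    {v : Fin r → Fin (r + 1) → ℂ} (hv : ∀ a, ∑ i, F i * v a i = 0)
    (hli : LinearIndependent ℂ v) :
    Matrix.det (Matrix.vecCons t v : Matrix (Fin (r + 1)) (Fin (r + 1)) ℂ) ≠ 0 := by
  intro h0
  obtain ⟨w, hw, hw0⟩ := Matrix.exists_vecMul_eq_zero_iff.2 h0
  have h1 : ∀ i, w 0 * t i + ∑ a, w (Fin.succ a) * v a i = 0 := by
    intro i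
    have := congrFun hw0 i
    simpa [Matrix.vecMul, dotProduct, Fin.sum_univ_succ] using this
  have h2 : w 0 = 0 := by
    have h3 : ∑ i, F i * (w 0 * t i + ∑ a, w (Fin.succ a) * v a i)
        = w 0 * ∑ i, F i * t i + ∑ a, w (Fin.succ a) * ∑ i, F i * v a i := by
      simp only [mul_add, Finset.sum_add_distrib, Finset.mul_sum]
      congr 1
      · exact Finset.sum_congr rfl fun i _ => mul_left_comm _ _ _
      · rw [Finset.sum_comm]
        exact Finset.sum_congr rfl fun i _ => Finset.sum_congr rfl fun a _ => mul_left_comm _ _ _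
    simpa [h1, ht, hv] using h3.symm
  refine hw (funext fun a => ?_)
  cases a using Fin.cases with
  | zero => exact h2
  | succ a =>
    refine Fintype.linearIndependent_iff.1 hli (fun a => w (Fin.succ a)) (funext fun i => ?_) a
    simpa [h2] using h1 i

variable {r : ℕ} {f : Fin (r + 1) → Cone Y → ℂ} {d e : Fin (r + 1) → ℤ} {m : ℤ}
  (hf : ∀ i, IsHomogeneous (f i) (d i)) (h : ∀ i, d i + e i = m)

/-- The coordinates at the point `x` of `U` of a vector in the fiber of `V_m`. -/
def syzCoord {y : Y} (x : {x : Punctured Y // proj x = y}) :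
    (syzBundle f hf h).fib y →ₗ[ℂ] (Fin (r + 1) → ℂ) where
  toFun v i := (v.1 i).1 x
  map_add' _ _ := rfl
  map_smul' _ _ := rfl

/-- The alternating form `(v_1, …, v_r) ↦ det (t, v_1(x), …, v_r(x))` on the fiber of `V_m`. -/
def detForm {y : Y} (x : {x : Punctured Y // proj x = y}) (t : Fin (r + 1) → ℂ) :
    (syzBundle f hf h).fib y [⋀^Fin r]→ₗ[ℂ] ℂ :=
  ((Matrix.detRowAlternating (n := Fin (r + 1)) (R := ℂ)).curryLeft t).compLinearMap
    (syzCoord hf h x)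

theorem detForm_apply {y : Y} (x : {x : Punctured Y // proj x = y}) (t : Fin (r + 1) → ℂ)
    (v : Fin r → (syzBundle f hf h).fib y) : detForm hf h x t v
      = Matrix.det (Matrix.vecCons t fun a => syzCoord hf h x (v a) :
        Matrix (Fin (r + 1)) (Fin (r + 1)) ℂ) := rfl

/-- The function `x ↦ det (t, v_1(x), …, v_r(x))` has weight `∑ e_i - m` on the orbit over `y`. -/
theorem detForm_smul {y : Y} {x x' : {x : Punctured Y // proj x = y}} {c : ℂˣ}
    (hc : x'.1 = c • x.1) (hx : ∃ i, f i x'.1.1 ≠ 0) {t t' : Fin (r + 1) → ℂ}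
    (ht : ∑ i, f i x.1.1 * t i = 1)
    (ht' : ∑ i, f i x'.1.1 * t' i = 1) (v : Fin r → (syzBundle f hf h).fib y) :
    detForm hf h x' t' v = (c : ℂ) ^ (∑ i, e i - m) * detForm hf h x t v := by
  have hcx : x'.1.1 = c • x.1.1 := congrArg Subtype.val hc
  -- `s` is `t` transported along the action
  let s : Fin (r + 1) → ℂ := fun i => (c : ℂ) ^ (-m) * ((c : ℂ) ^ e i * t i)
  have hs : ∑ i, f i x'.1.1 * s i = 1 := by
    rw [← ht]
    refine Finset.sum_congr rfl fun i _ => ?_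
    have h1 : (c : ℂ) ^ d i * ((c : ℂ) ^ (-m) * (c : ℂ) ^ e i) = 1 := by
      rw [← zpow_add₀ c.ne_zero, ← zpow_add₀ c.ne_zero]
      rw [show d i + (-m + e i) = 0 by linarith [h i], zpow_zero]
    rw [hcx, hf i c x.1.1]
    linear_combination (f i x.1.1 * t i) * h1
  have hF : (fun i => f i x'.1.1) ≠ 0 := fun h0 => hx.elim fun i hi => hi (congrFun h0 i)
  refine (det_vecCons_congr hF (ht'.trans hs.symm) (v := fun a => syzCoord hf h x' (v a))
    fun a => syz_relation hf h (v a) x').trans ?_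
  let M : Matrix (Fin (r + 1)) (Fin (r + 1)) ℂ := Matrix.vecCons t fun a => syzCoord hf h x (v a)
  have h2 : (Matrix.vecCons s fun a => syzCoord hf h x' (v a) :
      Matrix (Fin (r + 1)) (Fin (r + 1)) ℂ)
      = Matrix.of fun a i => (Fin.cons ((c : ℂ) ^ (-m)) (fun _ => 1) : Fin (r + 1) → ℂ) a *
        (Matrix.of fun a i => (c : ℂ) ^ e i * M a i) a i := by
    ext a i
    cases a using Fin.cases with
    | zero => rfl
    | succ a => exact (lineFib_apply ((v a).1 i) hc).trans (one_mul _).symm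
  rw [h2, Matrix.det_mul_column, Matrix.det_mul_row, Fin.prod_univ_succ]
  simp only [Fin.cons_zero, Fin.cons_succ, Finset.prod_const_one, mul_one]
  have h3 : (c : ℂ) ^ (∑ i, e i - m) = (c : ℂ) ^ (-m) * ∏ i, (c : ℂ) ^ e i := by
    rw [sub_eq_neg_add, zpow_add₀ c.ne_zero]
    congr 1
    induction (Finset.univ : Finset (Fin (r + 1))) using Finset.induction_on with
    | empty => simp
    | insert i S hi ih => rw [Finset.sum_insert hi, Finset.prod_insert hi, zpow_add₀ c.ne_zero, ih]
  rw [h3, mul_assoc]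
  rfl

theorem sum_single {F : Fin (r + 1) → ℂ} {i : Fin (r + 1)} (hi : F i ≠ 0) :
    ∑ k, F k * (Pi.single i (F i)⁻¹ : Fin (r + 1) → ℂ) k = 1 := by
  rw [Finset.sum_eq_single i]
  · rw [Pi.single_eq_same, mul_inv_cancel₀ hi]
  · intro k _ hk
    rw [Pi.single_eq_of_ne hk, mul_zero]
  · simp

theorem exists_transversal (zero : ∀ x : Cone Y, (∀ i, f i x = 0) ↔ x = vertex Y)
    (x : Punctured Y) : ∃ t : Fin (r + 1) → ℂ, ∑ i, f i x.1 * t i = 1 :=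
  let ⟨_, hi⟩ := exists_ne_zero zero x
  ⟨_, sum_single (F := fun i => f i x.1) hi⟩

variable (zero : ∀ x : Cone Y, (∀ i, f i x = 0) ↔ x = vertex Y)

/-- The form `v_1 ∧ … ∧ v_r ↦ det (t, v_1(x), …, v_r(x))`, where `∑ f_i(x) t_i = 1`. -/
def detLin {y : Y} (x : {x : Punctured Y // proj x = y}) :
    ⋀[ℂ]^r ((syzBundle f hf h).fib y) →ₗ[ℂ] ℂ :=
  exteriorPower.alternatingMapLinearEquiv
    (detForm hf h x (exists_transversal zero x.1).choose)

theorem detLin_ιMulti {y : Y} (x : {x : Punctured Y // proj x = y})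
    (v : Fin r → (syzBundle f hf h).fib y) : detLin hf h zero x (exteriorPower.ιMulti ℂ r v)
      = detForm hf h x (exists_transversal zero x.1).choose v :=
  exteriorPower.alternatingMapLinearEquiv_apply_ιMulti _ _

theorem detLin_ne_zero {y : Y} (x : {x : Punctured Y // proj x = y})
    (b : Module.Basis (Fin r) ℂ ((syzBundle f hf h).fib y)) :
    detLin hf h zero x (exteriorPower.ιMulti ℂ r b) ≠ 0 := by
  rw [detLin_ιMulti, detForm_apply]
  refine det_vecCons_ne_zero (exists_transversal zero x.1).choose_spec
    (fun a => syz_relation hf h (b a) x) ?_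
  refine b.linearIndependent.map' (syzCoord hf h x) (LinearMap.ker_eq_bot.2 ?_)
  exact fun v w hvw => syz_ext hf h x (congrFun hvw)

theorem detLin_bijective {y : Y} (x : {x : Punctured Y // proj x = y}) :
    Function.Bijective (detLin hf h zero x) := by
  obtain ⟨i, hi⟩ := exists_ne_zero zero x.1
  let b : Module.Basis (Fin r) ℂ ((syzBundle f hf h).fib y) :=
    Module.Basis.ofEquivFun (syzTriv hf h i x hi)
  have hfin : Module.Finite ℂ ((syzBundle f hf h).fib y) := Module.Finite.of_basis b
  have h1 : Module.finrank ℂ ((syzBundle f hf h).fib y) = r := by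
    simpa using Module.finrank_eq_card_basis b
  have h2 : Module.finrank ℂ (⋀[ℂ]^r ((syzBundle f hf h).fib y)) = Module.finrank ℂ ℂ := by
    rw [exteriorPower.finrank_eq, h1, Nat.choose_self, Module.finrank_self]
  have h3 : Function.Surjective (detLin hf h zero x) :=
    LinearMap.surjective fun h0 => detLin_ne_zero hf h zero x b (by rw [h0]; rfl)
  exact ⟨(LinearMap.injective_iff_surjective_of_finrank_eq_finrank h2).2 h3, h3⟩

/-- The isomorphism `Λ^r V_m ≅ H_Y^k`, `k = ∑ e_i - m`, on fibers: `v_1 ∧ … ∧ v_r` is mapped to the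
function `x ↦ det (t, v_1(x), …, v_r(x))`, where `∑ f_i(x) t_i = 1`. -/
def detEquiv (y : Y) :
    ⋀[ℂ]^r ((syzBundle f hf h).fib y) ≃ₗ[ℂ] (lineBundle Y (∑ i, e i - m)).fib y :=
  (LinearEquiv.ofBijective _ (detLin_bijective hf h zero (basePt Y y))).trans
    (evEquiv (∑ i, e i - m) (basePt Y y)).symm

theorem detEquiv_ιMulti {y : Y} (x : {x : Punctured Y // proj x = y}) {t : Fin (r + 1) → ℂ}
    (ht : ∑ i, f i x.1.1 * t i = 1) (v : Fin r → (syzBundle f hf h).fib y) :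
    (detEquiv hf h zero y (exteriorPower.ιMulti ℂ r v)).1 x = detForm hf h x t v := by
  obtain ⟨c, hc⟩ := exists_smul (basePt Y y) x
  rw [detForm_smul hf h hc (exists_ne_zero zero x.1)
    (exists_transversal zero (basePt Y y).1).choose_spec ht, lineFib_apply _ hc]
  congr 1
  exact (evEquiv_symm_apply_self _ _ _).trans (detLin_ιMulti hf h zero (basePt Y y) v)

theorem detEquiv_smul {y : Y} (x : {x : Punctured Y // proj x = y}) (a : ℂ)
    (ω : ⋀[ℂ]^r ((syzBundle f hf h).fib y)) :
    (detEquiv hf h zero y (a • ω)).1 x = a * (detEquiv hf h zero y ω).1 x :=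
  congrArg (fun φ : lineFib Y (∑ i, e i - m) y => φ.1 x) (map_smul (detEquiv hf h zero y) a ω)

theorem detEquiv_frame_ne_zero (T : LocTriv (syzBundle f hf h) r) (b : T.W)
    (x : {x : Punctured Y // proj x = b.1}) :
    (detEquiv hf h zero b.1 (exteriorPower.ιMulti ℂ r (T.frame b))).1 x ≠ 0 := by
  intro h0
  have h1 : detEquiv hf h zero b.1 (exteriorPower.ιMulti ℂ r (T.frame b)) = 0 :=
    lineFib_ext x h0
  rw [LinearEquiv.map_eq_zero_iff] at h1
  refine detLin_ne_zero hf h zero x (T.basis b) ?_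
  rw [show (T.basis b : Fin r → (syzBundle f hf h).fib b.1) = T.frame b from
    funext (T.basis_apply b), h1, map_zero]

theorem holAt_detEquiv_frame (hol : ∀ i x, HolAt (f i) x) (T : LocTriv (syzBundle f hf h) r)
    (σ : LocSec Y) {b : T.W} (hb : b.1 ∈ σ.W) : HolAt (fun b : T.W =>
      (detEquiv hf h zero b.1 (exteriorPower.ιMulti ℂ r (T.frame b))).1 (σ.sec b.1)) b := by
  obtain ⟨i, hi⟩ := exists_ne_zero zero (σ.sec b.1).1
  have hfi : HolAt (fun b : T.W => f i (σ.sec b.1).1.1) b :=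
    ((holMap_val _).at b).2 _ (σ.holAt_comp (hol i) hb)
  have h1 : ∀ᶠ z in nb b, Matrix.det (Matrix.vecCons (Pi.single i (f i (σ.sec z.1).1.1)⁻¹)
      fun a => syzCoord hf h (σ.sec z.1) (T.frame z a) : Matrix (Fin (r + 1)) (Fin (r + 1)) ℂ)
      = (detEquiv hf h zero z.1 (exteriorPower.ιMulti ℂ r (T.frame z))).1 (σ.sec z.1) := by
    filter_upwards [hfi.eventually_ne hi] with z hz
    exact (detEquiv_ιMulti hf h zero (σ.sec z.1)
      (sum_single (F := fun k => f k (σ.sec z.1).1.1) hz) (T.frame z)).symm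
  refine hol_congr h1 (HolAt.matrix_det fun a k => ?_)
  cases a using Fin.cases with
  | zero =>
    by_cases hk : k = i
    · subst hk
      simpa using hfi.inv hi
    · simpa [Pi.single_eq_of_ne hk] using holAt_const 0 b
  | succ a => exact ((σ.holMapAt_syz hf h hb).1 ((T.holMap_frame a).at b)).2 k

theorem isIso_detEquiv (hol : ∀ i x, HolAt (f i) x) :
    IsIso (E := (syzBundle f hf h).det r) (F := lineBundle Y (∑ i, e i - m))
      (detEquiv hf h zero) := by
  constructor
  · refine holMap_from_det fun T => holMap_iff.2 fun w => ?_
    obtain ⟨σ, hσ⟩ := exists_locSec w.1.1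
    refine (σ.holMapAt_line hσ).2 ⟨((holMap_val _).comp holMap_fst).at w, ?_⟩
    refine hol_congr (Filter.Eventually.of_forall fun z =>
      (detEquiv_smul hf h zero (σ.sec z.1.1) z.2 _).symm) ?_
    exact (holMapAt_complex.1 (holMap_snd.at w)).mul
      ((holMap_fst.at w).2 _ (holAt_detEquiv_frame hf h zero hol T σ hσ))
  · refine holMap_iff.2 fun p => ?_
    obtain ⟨σ, hσ⟩ := exists_locSec p.1
    obtain ⟨T, hT⟩ := syzBundle_isVectorBundle hf h hol zero p.1
    have hp := (σ.holMapAt_line hσ).1 (holMapAt_id p)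
    let β : (lineBundle Y (∑ i, e i - m)).Tot → T.W :=
      near (fun y => y ∈ T.W) ⟨p.1, hT⟩ fun q => q.1
    have hβ0 : ∀ᶠ q in nb p, q.1 ∈ T.W := hp.1.eventually (nb_of_isOpen T.isOpen hT)
    have hβ : HolMapAt β p := hp.1.near hβ0
    have hβp : β p = ⟨p.1, hT⟩ := near_val _ hT
    -- the coordinate in the chart of `T` is the quotient of the coordinate by that of the frame
    let D : T.W → ℂ := fun b =>
      (detEquiv hf h zero b.1 (exteriorPower.ιMulti ℂ r (T.frame b))).1 (σ.sec b.1)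
    have hD : HolAt (fun q => D (β q)) p :=
      hβ.2 D (holAt_detEquiv_frame hf h zero hol T σ (by rw [hβp]; exact hσ))
    have h1 : HolMapAt (fun q : (lineBundle Y (∑ i, e i - m)).Tot =>
        (β q, q.2.1 (σ.sec q.1) * (D (β q))⁻¹)) p :=
      holMapAt_prod.2 ⟨hβ, holMapAt_complex.2
        (hp.2.mul (hD.inv (detEquiv_frame_ne_zero hf h zero T _ _)))⟩
    refine (((holMap_detChart T).at _).comp h1).congr (hβ0.mono fun q hq => ?_)
    have h2 : β q = ⟨q.1, hq⟩ := near_val _ hq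
    rw [h2]
    refine congrArg (Sigma.mk q.1) ((LinearEquiv.eq_symm_apply _).2 (lineFib_ext (σ.sec q.1) ?_))
    refine (detEquiv_smul hf h zero (σ.sec q.1) _ _).trans ?_
    exact inv_mul_cancel_right₀ (detEquiv_frame_ne_zero hf h zero T ⟨q.1, hq⟩ _) _

end AffCone

end

open HolSpace LinearSpace AffCone TensorProduct in
theorem proposition2p1 {N n : ℕ} (Y : Set (Projectivization ℂ (Fin (N + 1) → ℂ)))
    (hY : IsSmoothProjectiveVariety Y) (hX : IsIntegrallyClosed (CoordRing Y))
    (f : Fin n → Cone Y → ℂ) (d : Fin n → ℤ)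
    (hol : ∀ i x, HolAt (f i) x) (hom : ∀ i, IsHomogeneous (f i) (d i))
    (zero : ∀ x : Cone Y, (∀ i, f i x = 0) ↔ x = vertex Y)
    (e : Fin n → ℤ) (m : ℤ) (hm : ∀ i, d i + e i = m) :
    -- (i) exact sequence of vector bundles
    ((syzBundle f hom hm).IsVectorBundle (n - 1) ∧
      (sumBundle Y e).IsVectorBundle n ∧
      (lineBundle Y m).IsVectorBundle 1 ∧
      IsHom (E := syzBundle f hom hm) (F := sumBundle Y e) (kerIncl (sumHom f hom hm)) ∧
      IsHom (E := sumBundle Y e) (F := lineBundle Y m) (sumHom f hom hm) ∧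
      ∀ y, Function.Injective (kerIncl (sumHom f hom hm) y) ∧
        Function.Exact (kerIncl (sumHom f hom hm) y) (sumHom f hom hm y) ∧
        Function.Surjective (sumHom f hom hm y)) ∧
    -- (ii) quotient by the action with weights `e_i`
    (@IsQuotient ℂˣ _ _ _ (relAction f hom hm) _ _ (relQuot f hom hm)) ∧
    -- (iii) determinant
    ((∃ ψ : ∀ y, ((syzBundle f hom hm).det (n - 1)).fib y ≃ₗ[ℂ]
        (lineBundle Y (∑ i, e i - m)).fib y,
        IsIso (E := (syzBundle f hom hm).det (n - 1)) (F := lineBundle Y (∑ i, e i - m)) ψ) ∧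
      ∑ i, e i - m = -∑ i, d i + ((n : ℤ) - 1) * m) ∧
    -- (iv) dependence on `m`
    (∀ (e' : Fin n → ℤ) (m' : ℤ) (hm' : ∀ i, d i + e' i = m'),
      (∃ ψ : ∀ y, ((syzBundle f hom hm).tensor (lineBundle Y (m' - m))).fib y ≃ₗ[ℂ]
          (syzBundle f hom hm').fib y,
        IsIso (E := (syzBundle f hom hm).tensor (lineBundle Y (m' - m)))
          (F := syzBundle f hom hm') ψ ∧
        ∀ y (v : (syzBundle f hom hm).fib y) (s : (lineBundle Y (m' - m)).fib y) i x,
          ((ψ y (v ⊗ₜ[ℂ] s)).1 i).1 x = (v.1 i).1 x * s.1 x) ∧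
      ∃ Ψ : ∀ y, Projectivization ℂ ((syzBundle f hom hm).fib y) ≃
          Projectivization ℂ ((syzBundle f hom hm').fib y),
        @Biholomorphic (syzBundle f hom hm).PTot (syzBundle f hom hm').PTot _ _
          (Equiv.sigmaCongrRight Ψ) ∧
        ∀ (p : relSpace f) (hp : (relQuot f hom hm p).2 ≠ 0) (hp' : (relQuot f hom hm' p).2 ≠ 0),
          Ψ (proj p.1.1) (Projectivization.mk ℂ (relQuot f hom hm p).2 hp)
            = Projectivization.mk ℂ (relQuot f hom hm' p).2 hp') := by
  obtain ⟨r, rfl⟩ : ∃ r, n = r + 1 := by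
    refine Nat.exists_eq_succ_of_ne_zero ?_
    -- for `n = 0` all points of the cone are common zeros, but `U` is nonempty
    rintro rfl
    obtain ⟨y⟩ := hY.nonempty.to_subtype
    obtain ⟨i, -⟩ := exists_ne_zero zero (basePt Y y).1
    exact i.elim0
  have hV : (syzBundle f hom hm).IsVectorBundle r := syzBundle_isVectorBundle hom hm hol zero
  refine ⟨⟨hV, sumBundle_isVectorBundle e, lineBundle_isVectorBundle m,
    isHom_ker (sumHom f hom hm), isHom_sumHom hom hm hol, fun y => ⟨Subtype.val_injective, ?_,
      sumHom_surjective hom hm zero y⟩⟩, isQuotient_relQuot hom hm,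
    ⟨⟨detEquiv hom hm zero, isIso_detEquiv hom hm zero hol⟩, ?_⟩, fun e' m' hm' =>
    ⟨⟨twistEquiv hom hm hm', isIso_twistEquiv hom hm hm' hV,
      fun y v s i x => twistEquiv_tmul hom hm hm' v s i x⟩,
      projEquiv hom hm hm', ⟨holMap_projEquiv hom hm hm', holMap_projEquiv hom hm' hm⟩,
      fun p hp hp' => ?_⟩⟩
  · exact LinearMap.exact_subtype_ker_map _
  · have h1 : ∑ i, (d i + e i) = ((r + 1 : ℕ) : ℤ) * m := by
      simp only [hm, Finset.sum_const, Finset.card_univ, Fintype.card_fin, nsmul_eq_mul]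
    rw [Finset.sum_add_distrib] at h1
    linear_combination h1
  · have h1 := syzCast_relQuot hom hm hm' p
    have h2 : syzCast hom hm hm' ⟨p.1.1, rfl⟩ (relQuot f hom hm p).2 ≠ 0 := by
      rw [h1]
      exact hp'
    refine (projEquiv_mk hom hm hm' ⟨p.1.1, rfl⟩ hp h2).trans ?_
    congr 1
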